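/- The rank-4 mixes of the regular convex 4-polytopes. Let $P_1=\{3,3,3\}$, $P_2=\{3,3,4\}$, $P_3=\{3,3,5\}$, $P_4=\{3,4,3\}$, $P_5=\{4,3,3\}$, $P_6=\{5,3,3\}$ be the (abstract) regular convex 4-polytopes, where the automorphism group of $\{p,q,r\}$ is the Coxeter group $[p,q,r]=\langle\rho_0,\rho_1,\rho_2,\rho_3\mid \rho_i^2,\ (\rho_0\rho_1)^p,\ (\rho_1\rho_2)^q,\ (\rho_2\rho_3)^r,\ (\rho_i\rho_j)^2\text{ for }|i-j|\ge 2\rangle$ and its rotation group $\Gamma^+(\{p,q,r\})$ is the subgroup generated by $\sigma_k=\rho_{k-1}\rho_k$, $k=1,2,3$. For $I\subseteq\{1,\dots,6\}$, the mix of the groups $\Gamma^+(P_i)$, $i\in I$, denoted $\Gamma^+(P_I)$, is the subgroup of $\prod_{i\in I}\Gamma^+(P_i)$ generated by the tuples $\beta_k=(\sigma_k^{(i)})_{i\in I}$, $k=1,2,3$. The mix $P_I$ is the poset of rank $4$ built from $\Gamma^+(P_I)$: its $j$-faces, $0\le j\le 3$, are the cosets of $A_j$, where $A_0=\langle\beta_2,\beta_3\rangle$,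 $A_1=\langle\beta_1\beta_2,\beta_3\rangle$, $A_2=\langle\beta_1,\beta_2\beta_3\rangle$, $A_3=\langle\beta_1,\beta_2\rangle$; there is one face of rank $-1$ and one of rank $4$ (for which $A_{-1}=A_4=\Gamma^+(P_I)$); and a $j$-face is below a $k$-face if and only if $j\le k$ and the two cosets intersect. A pre-polytope of rank $n$ is a poset with a strictly increasing rank function with values in $\{-1,\dots,n\}$ that has a least face, of rank $-1$, and a greatest face, of rank $n$, whose flags (maximal chains) all have $n+2$ elements, and such that whenever $F<G$ with $\operatorname{rank}F=j-1$ and $\operatorname{rank}G=j+1$ there are exactly two $j$-faces between $F$ and $G$. Two flags are adjacent if they differ in exactly one face. The pre-polytope is flag-connected if any two flags are joined by a sequence of successively adjacent flags. It is a polytope if any two flags $\Phi,\Psi$ are joined by such a sequence of flags all containing $\Phi\cap\Psi$. A mix is called polytopal if it is a polytope. Then for every $I\subseteq\{1,\dots,6\}$ we have $\Gamma^+(P_I)=\prod_{i\in I}\Gamma^+(P_i)$, and for every nonempty $I$ the poset $P_I$ is a flag-connected pre-polytope of rank $4$. For each of the $57$ sets $I$ with $|I|\ge 2$, the number $f_j$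 of $j$-faces of $P_I$ ($0\le j\le 3$), the number $g$ of flags of $P_I$, and whether $P_I$ is polytopal (Y) or not (N) are given by the following table. \[ \begin{array}{lrrrrrc} I & f_0 & f_1 & f_2 & f_3 & g & \text{polytopal}\\ \hline \{1,2\} & 40 & 480 & 1920 & 960 & 23040 & \text{Y} \\ \{1,3\} & 600 & 14400 & 72000 & 36000 & 864000 & \text{Y} \\ \{1,4\} & 120 & 5760 & 5760 & 120 & 69120 & \text{Y} \\ \{1,5\} & 960 & 1920 & 480 & 40 & 23040 & \text{Y} \\ \{1,6\} & 36000 & 72000 & 14400 & 600 & 864000 & \text{Y} \\ \{2,3\} & 960 & 34560 & 230400 & 115200 & 2764800 & \text{Y} \\ \{2,4\} & 192 & 4608 & 18432 & 384 & 221184 & \text{Y} \\ \{2,5\} & 128 & 1536 & 1536 & 128 & 73728 & \text{N} \\ \{2,6\} & 4800 & 57600 & 46080 & 1920 & 2764800 & \text{N} \\ \{3,4\} & 2880 & 138240 & 691200 & 14400 & 8294400 & \text{Y} \\ \{3,5\} & 1920 & 46080 & 57600 & 4800 & 2764800 & \text{N} \\ \{3,6\} & 72000 & 1728000 & 1728000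 & 72000 & 103680000 & \text{N} \\ \{4,5\} & 384 & 18432 & 4608 & 192 & 221184 & \text{Y} \\ \{4,6\} & 14400 & 691200 & 138240 & 2880 & 8294400 & \text{Y} \\ \{5,6\} & 115200 & 230400 & 34560 & 960 & 2764800 & \text{Y} \\ \{1,2,3\} & 4800 & 691200 & 13824000 & 6912000 & 165888000 & \text{Y} \\ \{1,2,4\} & 960 & 276480 & 1105920 & 23040 & 13271040 & \text{Y} \\ \{1,2,5\} & 7680 & 92160 & 92160 & 7680 & 4423680 & \text{Y} \\ \{1,2,6\} & 288000 & 3456000 & 2764800 & 115200 & 165888000 & \text{Y} \\ \{1,3,4\} & 14400 & 8294400 & 41472000 & 864000 & 497664000 & \text{Y} \\ \{1,3,5\} & 115200 & 2764800 & 3456000 & 288000 & 165888000 & \text{Y} \\ \{1,3,6\} & 4320000 & 103680000 & 103680000 & 4320000 & 6220800000 & \text{Y} \\ \{1,4,5\} & 23040 & 1105920 & 276480 & 960 & 13271040 & \text{Y} \\ \{1,4,6\} & 864000 & 41472000 & 8294400 & 14400 & 497664000 & \text{Y} \\ \{1,5,6\} & 6912000 & 13824000 & 691200 & 4800 & 165888000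 & \text{Y} \\ \{2,3,4\} & 23040 & 6635520 & 132710400 & 2764800 & 1592524800 & \text{Y} \\ \{2,3,5\} & 15360 & 2211840 & 11059200 & 921600 & 530841600 & \text{N} \\ \{2,3,6\} & 576000 & 82944000 & 331776000 & 13824000 & 19906560000 & \text{N} \\ \{2,4,5\} & 3072 & 884736 & 884736 & 3072 & 42467328 & \text{N} \\ \{2,4,6\} & 115200 & 33177600 & 26542080 & 46080 & 1592524800 & \text{N} \\ \{2,5,6\} & 921600 & 11059200 & 2211840 & 15360 & 530841600 & \text{N} \\ \{3,4,5\} & 46080 & 26542080 & 33177600 & 115200 & 1592524800 & \text{N} \\ \{3,4,6\} & 1728000 & 995328000 & 995328000 & 1728000 & 59719680000 & \text{N} \\ \{3,5,6\} & 13824000 & 331776000 & 82944000 & 576000 & 19906560000 & \text{N} \\ \{4,5,6\} & 2764800 & 132710400 & 6635520 & 23040 & 1592524800 & \text{Y} \\ \{1,2,3,4\} & 115200 & 398131200 & 7962624000 & 165888000 & 95551488000 & \text{Y} \\ \{1,2,3,5\} & 921600 & 132710400 & 663552000 & 55296000 & 31850496000 & \text{Y} \\ \{1,2,3,6\} & 34560000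 & 4976640000 & 19906560000 & 829440000 & 1194393600000 & \text{Y} \\ \{1,2,4,5\} & 184320 & 53084160 & 53084160 & 184320 & 2548039680 & \text{Y} \\ \{1,2,4,6\} & 6912000 & 1990656000 & 1592524800 & 2764800 & 95551488000 & \text{Y} \\ \{1,2,5,6\} & 55296000 & 663552000 & 132710400 & 921600 & 31850496000 & \text{Y} \\ \{1,3,4,5\} & 2764800 & 1592524800 & 1990656000 & 6912000 & 95551488000 & \text{Y} \\ \{1,3,4,6\} & 103680000 & 59719680000 & 59719680000 & 103680000 & 3583180800000 & \text{Y} \\ \{1,3,5,6\} & 829440000 & 19906560000 & 4976640000 & 34560000 & 1194393600000 & \text{Y} \\ \{1,4,5,6\} & 165888000 & 7962624000 & 398131200 & 115200 & 95551488000 & \text{Y} \\ \{2,3,4,5\} & 368640 & 1274019840 & 6370099200 & 22118400 & 305764761600 & \text{N} \\ \{2,3,4,6\} & 13824000 & 47775744000 & 191102976000 & 331776000 & 11466178560000 & \text{N} \\ \{2,3,5,6\} & 110592000 & 15925248000 & 15925248000 & 110592000 & 3822059520000 & \text{N} \\ \{2,4,5,6\} & 22118400 & 6370099200 & 1274019840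 & 368640 & 305764761600 & \text{N} \\ \{3,4,5,6\} & 331776000 & 191102976000 & 47775744000 & 13824000 & 11466178560000 & \text{N} \\ \{1,2,3,4,5\} & 22118400 & 76441190400 & 382205952000 & 1327104000 & 18345885696000 & \text{Y} \\ \{1,2,3,4,6\} & 829440000 & 2866544640000 & 11466178560000 & 19906560000 & 687970713600000 & \text{Y} \\ \{1,2,3,5,6\} & 6635520000 & 955514880000 & 955514880000 & 6635520000 & 229323571200000 & \text{Y} \\ \{1,2,4,5,6\} & 1327104000 & 382205952000 & 76441190400 & 22118400 & 18345885696000 & \text{Y} \\ \{1,3,4,5,6\} & 19906560000 & 11466178560000 & 2866544640000 & 829440000 & 687970713600000 & \text{Y} \\ \{2,3,4,5,6\} & 2654208000 & 9172942848000 & 9172942848000 & 2654208000 & 2201506283520000 & \text{N} \\ \{1,2,3,4,5,6\} & 159252480000 & 550376570880000 & 550376570880000 & 159252480000 & 132090377011200000 & \text{Y} \end{array} \] In particular $\{3,3,4\}\diamond\{4,3,3\}$, the case $I=\{2,5\}$, is not polytopal. -/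

import Mathlib

/-!
Abstract polytopes, the poset built from a group with specified rotation generators,
the mix of groups with specified generators, and the regular convex 4-polytopes.
-/

namespace PolytopeMix

section Polytopes

variable {F : Type*} [LE F]

/-- Two flags (maximal chains) are adjacent if they differ in exactly one face. -/
def FlagAdjacent (Φ Ψ : Flag F) : Prop :=
  ((Φ : Set F) \ Ψ).ncard = 1 ∧ ((Ψ : Set F) \ Φ).ncard = 1

/-- Any two flags are joined by a sequence of successively adjacent flags. -/
def FlagConnected (F : Type*) [LE F] : Prop :=
  ∀ Φ Ψ : Flag F, Relation.ReflTransGen FlagAdjacent Φ Ψ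

/-- Any two flags `Φ`, `Ψ` are joined by a sequence of successively adjacent flags, all of
which contain `Φ ∩ Ψ`. -/
def StronglyFlagConnected (F : Type*) [LE F] : Prop :=
  ∀ Φ Ψ : Flag F,
    Relation.ReflTransGen
      (fun A B : Flag F => FlagAdjacent A B ∧
        (Φ : Set F) ∩ Ψ ⊆ A ∧ (Φ : Set F) ∩ Ψ ⊆ B) Φ Ψ

/-- `F`, with its relation `≤` and the rank function `rank`, is a pre-polytope of rank `n`. -/
structure IsPrePolytope (F : Type*) [LE F] (rank : F → ℤ) (n : ℕ) : Prop where
  le_refl : ∀ x : F, x ≤ x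
  le_trans : ∀ x y z : F, x ≤ y → y ≤ z → x ≤ z
  le_antisymm : ∀ x y : F, x ≤ y → y ≤ x → x = y
  rank_lt : ∀ x y : F, x ≤ y → x ≠ y → rank x < rank y
  rank_mem : ∀ x : F, -1 ≤ rank x ∧ rank x ≤ n
  exists_least : ∃ x : F, rank x = -1 ∧ ∀ y, x ≤ y
  exists_greatest : ∃ x : F, rank x = n ∧ ∀ y, y ≤ x
  card_flag : ∀ Φ : Flag F, (Φ : Set F).ncard = n + 2
  diamond : ∀ (j : ℤ) (x y : F), x ≤ y → rank x = j - 1 → rank y = j + 1 →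
    {z : F | rank z = j ∧ x ≤ z ∧ z ≤ y}.ncard = 2

/-- An abstract polytope of rank `n`. -/
structure IsPolytope (F : Type*) [LE F] (rank : F → ℤ) (n : ℕ) : Prop
    extends IsPrePolytope F rank n where
  stronglyFlagConnected : StronglyFlagConnected F

end Polytopes

section PosetOfGroup

variable {G : Type*} [Group G] {m : ℕ}

/-- With the generators numbered `σ 0, …, σ (m - 1)` (so that `σ k` plays the role of
`σ_{k+1} = ρ_k ρ_{k+1}`), this is `τ_{a+1,b} = σ_{a+1} ⋯ σ_b`, i.e. `ρ_a ρ_b`, for `a < b`. -/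
def tau (σ : Fin m → G) (a b : ℕ) : G :=
  (((List.ofFn σ).drop a).take (b - a)).prod

/-- The subgroup `Γ⁺_J = ⟨τ_{i,j} : i ≤ j and i - 1, j ∈ J⟩` for a set `J` of elements of
`{0, …, m}`. -/
def partGroup (σ : Fin m → G) (J : Set (Fin (m + 1))) : Subgroup G :=
  Subgroup.closure {g | ∃ a b : Fin (m + 1), a < b ∧ a ∈ J ∧ b ∈ J ∧ g = tau σ a b}

/-- The stabilizer of the base face of rank `r - 1`, namely `Γ⁺_J` with
`J = {0, …, m} \ {r - 1}`; for the two improper faces this is all of `⟨σ 0, …, σ (m - 1)⟩`. -/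
def faceGroup (σ : Fin m → G) (r : Fin (m + 3)) : Subgroup G :=
  partGroup σ {a | (a : ℕ) + 1 ≠ r}

/-- The faces of the poset of rank `m + 1` built from the group `G` with generators `σ`: the
faces of rank `r - 1` are the cosets of the stabilizer of the base face of that rank. -/
@[ext]
structure Face (σ : Fin m → G) where
  /-- the rank of the face, plus one -/
  idx : Fin (m + 3)
  coset : G ⧸ faceGroup σ idx

/-- Two faces are incident if their cosets meet. -/
instance (σ : Fin m → G) : LE (Face σ) where
  le x y := x.idx ≤ y.idx ∧
    ∃ g : G, (g : G ⧸ faceGroup σ x.idx) = x.coset ∧ (g : G ⧸ faceGroup σ y.idx) = y.coset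

/-- The rank of a face, between `-1` and `m + 1`. -/
def Face.rank {σ : Fin m → G} (x : Face σ) : ℤ := (x.idx : ℕ) - 1

end PosetOfGroup

section Mix

variable {ι : Type*} {G : ι → Type*} [∀ i, Group (G i)] {m : ℕ}

/-- The mix of a family of groups with `m` specified generators each: the subgroup of the direct
product generated by the tuples of corresponding generators. -/
def mix (x : ∀ i, Fin m → G i) : Subgroup (∀ i, G i) :=
  Subgroup.closure (Set.range fun k : Fin m => fun i => x i k)

/-- The specified generators of the mix. -/
def mixGen (x : ∀ i, Fin m → G i) (k : Fin m) : mix x :=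
  ⟨fun i => x i k, Subgroup.subset_closure ⟨k, rfl⟩⟩

end Mix

/-- Labels of the six regular convex 4-polytopes. -/
inductive Convex4 : Type
  | P₁ | P₂ | P₃ | P₄ | P₅ | P₆
  deriving DecidableEq

open Convex4

instance : Fintype Convex4 where
  elems := {P₁, P₂, P₃, P₄, P₅, P₆}
  complete := by intro i; cases i <;> decide

/-- The Schläfli symbols. -/
def schlafli : Convex4 → Fin 3 → ℕ
  | P₁ => ![3, 3, 3]
  | P₂ => ![3, 3, 4]
  | P₃ => ![3, 3, 5]
  | P₄ => ![3, 4, 3]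
  | P₅ => ![4, 3, 3]
  | P₆ => ![5, 3, 3]

/-- The Coxeter matrix of the string Coxeter group `[p, q, r]`. -/
def coxeterMatrix (i : Convex4) : CoxeterMatrix (Fin 4) where
  M := !![1, schlafli i 0, 2, 2;
          schlafli i 0, 1, schlafli i 1, 2;
          2, schlafli i 1, 1, schlafli i 2;
          2, 2, schlafli i 2, 1]
  isSymm := by cases i <;> decide
  diagonal := by cases i <;> decide
  off_diagonal := by cases i <;> intro a b <;> fin_cases a <;> fin_cases b <;> decide

/-- The rotation `ρ_k ρ_{k+1}` in the Coxeter group `[p, q, r]`, the automorphism group of the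
(universal) polytope `{p, q, r}`. -/
def rotation (i : Convex4) (k : Fin 3) : (coxeterMatrix i).Group :=
  (coxeterMatrix i).simple k.castSucc * (coxeterMatrix i).simple k.succ

/-- The rotation subgroup `Γ⁺(P_i)` of the Coxeter group `[p, q, r] = Γ(P_i)`. -/
def rotationGroup (i : Convex4) : Subgroup (coxeterMatrix i).Group :=
  Subgroup.closure (Set.range (rotation i))

/-- The specified generators of `Γ⁺(P_i)`. -/
def rotationGen (i : Convex4) (k : Fin 3) : rotationGroup i :=
  ⟨rotation i k, Subgroup.subset_closure ⟨k, rfl⟩⟩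

/-- The rotation group of the mix `P_I`, inside the direct product of the `Γ⁺(P_i)`, `i ∈ I`. -/
def mixRotationGroup (I : Finset Convex4) : Subgroup (∀ i : I, rotationGroup i) :=
  mix fun i : I => rotationGen i

/-- The specified generators of the rotation group of the mix `P_I`. -/
def mixRotationGen (I : Finset Convex4) : Fin 3 → mixRotationGroup I :=
  mixGen fun i : I => rotationGen i

/-- The mix `P_I`: the poset of rank 4 built from its rotation group. -/
abbrev Mix (I : Finset Convex4) : Type := Face (mixRotationGen I)

/-- The number of `k`-faces of `P_I`. -/
noncomputable def numFaces (I : Finset Convex4) (k : ℤ) : ℕ :=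
  Nat.card {x : Mix I // x.rank = k}

/-- The number of flags of `P_I`. -/
noncomputable def numFlags (I : Finset Convex4) : ℕ := Nat.card (Flag (Mix I))

/-- A row of the table of mixes: a set of polytopes, the numbers of faces of ranks 0 to 3 and of
flags of the mix, and whether the mix is polytopal. -/
structure Row where
  I : Finset Convex4
  f₀ : ℕ
  f₁ : ℕ
  f₂ : ℕ
  f₃ : ℕ
  g : ℕ
  polytopal : Bool

/-- The table of the mixes of two or more regular convex 4-polytopes. -/
def mixTable : List Row := [
  ⟨{P₁, P₂}, 40, 480, 1920, 960, 23040, true⟩,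
  ⟨{P₁, P₃}, 600, 14400, 72000, 36000, 864000, true⟩,
  ⟨{P₁, P₄}, 120, 5760, 5760, 120, 69120, true⟩,
  ⟨{P₁, P₅}, 960, 1920, 480, 40, 23040, true⟩,
  ⟨{P₁, P₆}, 36000, 72000, 14400, 600, 864000, true⟩,
  ⟨{P₂, P₃}, 960, 34560, 230400, 115200, 2764800, true⟩,
  ⟨{P₂, P₄}, 192, 4608, 18432, 384, 221184, true⟩,
  ⟨{P₂, P₅}, 128, 1536, 1536, 128, 73728, false⟩,
  ⟨{P₂, P₆}, 4800, 57600, 46080, 1920, 2764800, false⟩,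
  ⟨{P₃, P₄}, 2880, 138240, 691200, 14400, 8294400, true⟩,
  ⟨{P₃, P₅}, 1920, 46080, 57600, 4800, 2764800, false⟩,
  ⟨{P₃, P₆}, 72000, 1728000, 1728000, 72000, 103680000, false⟩,
  ⟨{P₄, P₅}, 384, 18432, 4608, 192, 221184, true⟩,
  ⟨{P₄, P₆}, 14400, 691200, 138240, 2880, 8294400, true⟩,
  ⟨{P₅, P₆}, 115200, 230400, 34560, 960, 2764800, true⟩,
  ⟨{P₁, P₂, P₃}, 4800, 691200, 13824000, 6912000, 165888000, true⟩,
  ⟨{P₁, P₂, P₄}, 960, 276480, 1105920, 23040, 13271040, true⟩,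
  ⟨{P₁, P₂, P₅}, 7680, 92160, 92160, 7680, 4423680, true⟩,
  ⟨{P₁, P₂, P₆}, 288000, 3456000, 2764800, 115200, 165888000, true⟩,
  ⟨{P₁, P₃, P₄}, 14400, 8294400, 41472000, 864000, 497664000, true⟩,
  ⟨{P₁, P₃, P₅}, 115200, 2764800, 3456000, 288000, 165888000, true⟩,
  ⟨{P₁, P₃, P₆}, 4320000, 103680000, 103680000, 4320000, 6220800000, true⟩,
  ⟨{P₁, P₄, P₅}, 23040, 1105920, 276480, 960, 13271040, true⟩,
  ⟨{P₁, P₄, P₆}, 864000, 41472000, 8294400, 14400, 497664000, true⟩,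
  ⟨{P₁, P₅, P₆}, 6912000, 13824000, 691200, 4800, 165888000, true⟩,
  ⟨{P₂, P₃, P₄}, 23040, 6635520, 132710400, 2764800, 1592524800, true⟩,
  ⟨{P₂, P₃, P₅}, 15360, 2211840, 11059200, 921600, 530841600, false⟩,
  ⟨{P₂, P₃, P₆}, 576000, 82944000, 331776000, 13824000, 19906560000, false⟩,
  ⟨{P₂, P₄, P₅}, 3072, 884736, 884736, 3072, 42467328, false⟩,
  ⟨{P₂, P₄, P₆}, 115200, 33177600, 26542080, 46080, 1592524800, false⟩,
  ⟨{P₂, P₅, P₆}, 921600, 11059200, 2211840, 15360, 530841600, false⟩,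
  ⟨{P₃, P₄, P₅}, 46080, 26542080, 33177600, 115200, 1592524800, false⟩,
  ⟨{P₃, P₄, P₆}, 1728000, 995328000, 995328000, 1728000, 59719680000, false⟩,
  ⟨{P₃, P₅, P₆}, 13824000, 331776000, 82944000, 576000, 19906560000, false⟩,
  ⟨{P₄, P₅, P₆}, 2764800, 132710400, 6635520, 23040, 1592524800, true⟩,
  ⟨{P₁, P₂, P₃, P₄}, 115200, 398131200, 7962624000, 165888000, 95551488000, true⟩,
  ⟨{P₁, P₂, P₃, P₅}, 921600, 132710400, 663552000, 55296000, 31850496000, true⟩,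
  ⟨{P₁, P₂, P₃, P₆}, 34560000, 4976640000, 19906560000, 829440000, 1194393600000, true⟩,
  ⟨{P₁, P₂, P₄, P₅}, 184320, 53084160, 53084160, 184320, 2548039680, true⟩,
  ⟨{P₁, P₂, P₄, P₆}, 6912000, 1990656000, 1592524800, 2764800, 95551488000, true⟩,
  ⟨{P₁, P₂, P₅, P₆}, 55296000, 663552000, 132710400, 921600, 31850496000, true⟩,
  ⟨{P₁, P₃, P₄, P₅}, 2764800, 1592524800, 1990656000, 6912000, 95551488000, true⟩,
  ⟨{P₁, P₃, P₄, P₆}, 103680000, 59719680000, 59719680000, 103680000, 3583180800000, true⟩,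
  ⟨{P₁, P₃, P₅, P₆}, 829440000, 19906560000, 4976640000, 34560000, 1194393600000, true⟩,
  ⟨{P₁, P₄, P₅, P₆}, 165888000, 7962624000, 398131200, 115200, 95551488000, true⟩,
  ⟨{P₂, P₃, P₄, P₅}, 368640, 1274019840, 6370099200, 22118400, 305764761600, false⟩,
  ⟨{P₂, P₃, P₄, P₆}, 13824000, 47775744000, 191102976000, 331776000, 11466178560000, false⟩,
  ⟨{P₂, P₃, P₅, P₆}, 110592000, 15925248000, 15925248000, 110592000, 3822059520000, false⟩,
  ⟨{P₂, P₄, P₅, P₆}, 22118400, 6370099200, 1274019840, 368640, 305764761600, false⟩,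
  ⟨{P₃, P₄, P₅, P₆}, 331776000, 191102976000, 47775744000, 13824000, 11466178560000, false⟩,
  ⟨{P₁, P₂, P₃, P₄, P₅}, 22118400, 76441190400, 382205952000, 1327104000, 18345885696000, true⟩,
  ⟨{P₁, P₂, P₃, P₄, P₆}, 829440000, 2866544640000, 11466178560000, 19906560000, 687970713600000, true⟩,
  ⟨{P₁, P₂, P₃, P₅, P₆}, 6635520000, 955514880000, 955514880000, 6635520000, 229323571200000, true⟩,
  ⟨{P₁, P₂, P₄, P₅, P₆}, 1327104000, 382205952000, 76441190400, 22118400, 18345885696000, true⟩,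
  ⟨{P₁, P₃, P₄, P₅, P₆}, 19906560000, 11466178560000, 2866544640000, 829440000, 687970713600000, true⟩,
  ⟨{P₂, P₃, P₄, P₅, P₆}, 2654208000, 9172942848000, 9172942848000, 2654208000, 2201506283520000, false⟩,
  ⟨{P₁, P₂, P₃, P₄, P₅, P₆}, 159252480000, 550376570880000, 550376570880000, 159252480000, 132090377011200000, true⟩
]

end PolytopeMix

open PolytopeMix

/-!
Everything is computed in full Coxeter groups rather than in rotation groups. The rotation group of
the mix `P_I` embeds in the product `E` of the Coxeter groups of the `P_i`, `i ∈ I`, as the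
subgroup generated by the products of two of the tuples `α k = (ρ_k)_i`, the tuples of
corresponding reflections. The faces of `P_I` then become cosets of the subgroups generated by
three of the `α k`, and the flags become the elements of the group generated by all four. For an
arbitrary `IsStringGroup` this translates the order-theoretic notions: if the few instances of the
intersection property collected in `IsThin` hold, then the poset is a flag-connected pre-polytope,
it has twice as many flags as its rotation group has elements, and it is a polytope if and only if
`⟨α a | a ∈ J⟩ = ⋂ k ∉ J, ⟨α a | a ≠ k⟩` for all `J` (`IsStringGroup.isPolytope_iff`).

The facts needed about the single groups `[p, q, r]` are their orders, those of their parabolic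
subgroups, the intersection property, and that the Coxeter group of the vertex-figure or of the
facet embeds. All follow from the statement that the stabilizer of a fundamental weight in a
parabolic subgroup is the parabolic subgroup without the corresponding node. This is a coset
enumeration over the orbit of the weight, which is ordered such that every step goes down
(`DescentCheck`). The reflection representation is reduced to the field with 31 elements, where
`2 cos (π / m)` exists for `m = 3, 4, 5`, so that the orbits are finite lists of numbers and the
hypotheses of the enumeration can be evaluated.

In each `P_i` other than `P₁` some generating rotation has an order that is prime to the orders of
the corresponding rotations of the other polytopes, and the remaining generators have order 3. A
power of the corresponding generator of the mix is therefore trivial in all factors but one, in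
which it normally generates the rotation group. Hence the mix is the whole direct product
(`closure_rotations_eq_pi`). The same argument in rank 3 shows that the rotation group of the
vertex-figure of `P_I` is the direct product of the rotation groups of the different vertex-figures
of the `P_i`, each embedded diagonally, and likewise for the facets. The stabilizers of a base edge
and of a base 2-face are dihedral groups. This gives the orders of all stabilizers and the numbers
of faces.

Of the intersection property, only one instance can fail in the mix (`isPolytope_iff`): the groups
of vertex-figure and facet may intersect in more than the powers of the rotation `α 1 * α 2`. An
element of the intersection that preserves orientation is a tuple of powers of the rotations
`ρ_1 ρ_2` of the `P_i`, with equal exponents in any two polytopes that have the same vertex-figures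
(those among `P₁`, `P₅`, `P₆`) or the same facets (those among `P₁`, `P₂`, `P₃`). All these
rotations have order 3, while that of `P₄` has order 4 and imposes no condition. If `P₁ ∈ I`, or if
`I` avoids `{P₂, P₃}` or `{P₅, P₆}`, then all the exponents are thus equal modulo 3, and the tuple
is a power of `α 1 * α 2`. Otherwise the tuple that is the rotation in `P₅` and `P₆` and trivial
elsewhere is a counterexample.
-/

open PolytopeMix

namespace PolytopeMix

open Convex4

/-! ### Coset enumeration by descent -/

section Descent

variable {X κ : Type*}

/-- The hypotheses of coset enumeration by descent, for the list `L` with numbering `h`. The list is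
closed under the maps `act a`, `a ∈ J`, of which only `act k` moves the first entry `b`. Every other
entry `x` has a neighbour `act t x` of smaller height, and whenever `act a x` is not higher than `x`
either, all points but `x` and `act a x` of the cycle through `x` that arises by alternately
applying `act t` and `act a` are lower than `x`. -/
def DescentCheck (act : κ → X → X) (m : κ → κ → ℕ) (J : List κ) (k : κ) (b : X) (L : List X)
    (h : X → ℕ) : Prop :=
  h b = 0 ∧ (∀ a ∈ J, act a b = b ↔ a ≠ k) ∧ L.map h = List.range L.length ∧ 0 < L.length ∧
  ∀ x ∈ L, (∀ a ∈ J, h (act a x) < L.length) ∧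
    (h x = 0 ∨ ∃ t ∈ J, h (act t x) < h x ∧
      ∀ a ∈ J, a ≠ t → h x < h (act a x) ∨
        2 ≤ m a t ∧ ∀ j < m a t - 1,
          h ((act t ∘ act a)^[j] (act t x)) < h x ∧
          h (act a ((act t ∘ act a)^[j] (act t x))) < h x)

instance [DecidableEq κ] [DecidableEq X] (act : κ → X → X) (m : κ → κ → ℕ) (J : List κ) (k : κ)
    (b : X) (L : List X) (h : X → ℕ) : Decidable (DescentCheck act m J k b L h) := by
  unfold DescentCheck; infer_instance

variable {G : Type*} [Group G] {s : κ → G} {φ : G →* Equiv.Perm X} {act : κ → X → X}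
  {m : κ → κ → ℕ} {J : List κ} {k : κ} {b : X} {L : List X} {h : X → ℕ}

theorem braid_of_pow_eq_one {G : Type*} [Group G] {a t : G} {n : ℕ} (ha : a * a = 1)
    (ht : t * t = 1) (h : (a * t) ^ (n + 2) = 1) : t * a * (t * a) ^ n * t = a := by
  have hinv : t * a = (a * t)⁻¹ := by
    rw [mul_inv_rev, inv_eq_of_mul_eq_one_left ha, inv_eq_of_mul_eq_one_left ht]
  have h2 : (t * a) ^ (n + 1) * t * a = 1 := by
    rw [mul_assoc, ← pow_succ, hinv, inv_pow, h, inv_one]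
  rw [← pow_succ', eq_inv_of_mul_eq_one_left h2, inv_eq_of_mul_eq_one_left ha]

/-- The cosets of `K` are labelled by the points of `L`, compatibly with the generators: this is
coset enumeration, run upwards along `h`. An edge from `x` to `act a x` is deduced from the relation
`(s a * s t) ^ m = 1`, all of whose other edges at `x` lie lower or lead to `act t x`. -/
theorem DescentCheck.exists_label (hc : DescentCheck act m J k b L h)
    (hrel : ∀ a ∈ J, ∀ t ∈ J, (s a * s t) ^ m a t = 1) (hinv : ∀ a ∈ J, s a * s a = 1)
    (hφ : ∀ a ∈ J, ∀ x, φ (s a) x = act a x) (hmem : ∀ y, h y < L.length → y ∈ L)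
    (K : Subgroup G) (hK : ∀ a ∈ J, a ≠ k → s a ∈ K) :
    ∃ c : X → G ⧸ K, c b = ((1 : G) : G ⧸ K) ∧ ∀ x ∈ L, ∀ a ∈ J, s a • c x = c (act a x) := by
  classical
  obtain ⟨hb, hfix, hrange, hpos, hstep⟩ := hc
  have hinj : ∀ x ∈ L, ∀ y ∈ L, h x = h y → x = y := fun x hx y hy hxy =>
    List.inj_on_of_nodup_map (f := h) (hrange ▸ List.nodup_range) hx hy hxy
  have hbL : b ∈ L := hmem b (hb ▸ hpos)
  have hact : ∀ a ∈ J, ∀ x, act a (act a x) = x := fun a ha x => by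
    rw [← hφ a ha, ← hφ a ha, ← Equiv.Perm.mul_apply, ← map_mul, hinv a ha, map_one]; rfl
  have hL : ∀ a ∈ J, ∀ x ∈ L, act a x ∈ L := fun a ha x hx => hmem _ ((hstep x hx).1 a ha)
  have hdesc : ∀ x, ∃ t : κ, x ∈ L → h x ≠ 0 → t ∈ J ∧ h (act t x) < h x ∧
      ∀ a ∈ J, a ≠ t → h x < h (act a x) ∨
        2 ≤ m a t ∧ ∀ j < m a t - 1,
          h ((act t ∘ act a)^[j] (act t x)) < h x ∧
          h (act a ((act t ∘ act a)^[j] (act t x))) < h x := by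
    intro x
    by_cases hx : x ∈ L ∧ h x ≠ 0
    · obtain ⟨t, ht⟩ := (hstep x hx.1).2.resolve_left hx.2
      exact ⟨t, fun _ _ => ht⟩
    · exact ⟨k, fun h1 h2 => absurd ⟨h1, h2⟩ hx⟩
  choose par hpar using hdesc
  obtain ⟨c, hcdef⟩ : ∃ c : X → G ⧸ K, ∀ x, c x =
      if h (act (par x) x) < h x then s (par x) • c (act (par x) x) else ((1 : G) : G ⧸ K) := by
    refine ⟨WellFounded.fix (measure h).wf fun x ih =>
      if hx : h (act (par x) x) < h x then s (par x) • ih _ hx else ((1 : G) : G ⧸ K),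
      fun x => ?_⟩
    rw [WellFounded.fix_eq]
    split <;> rfl
  have hcb : c b = ((1 : G) : G ⧸ K) := by rw [hcdef, if_neg (by simp [hb])]
  refine ⟨c, hcb, ?_⟩
  have key : ∀ N, ∀ x ∈ L, h x < N → ∀ a ∈ J, h (act a x) < N → s a • c x = c (act a x) := by
    intro N
    induction N with
    | zero => intro x _ hx; omega
    | succ N ih =>
      have top : ∀ x ∈ L, h x = N → ∀ a ∈ J, h (act a x) ≤ N → s a • c x = c (act a x) := by
        intro x hx hxN a ha hax
        by_cases h0 : h x = 0
        · obtain rfl : x = b := hinj _ hx _ hbL (h0.trans hb.symm)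
          have hfx : act a x = x := hinj _ (hL a ha x hx) _ hx (by omega)
          have hsK := hK a ha ((hfix a ha).1 hfx)
          rw [hfx, hcb, MulAction.Quotient.smul_coe, smul_eq_mul, mul_one]
          exact (QuotientGroup.eq (s := K)).2 (by simpa using hsK)
        · obtain ⟨htJ, hlt, hall⟩ := hpar x hx h0
          set t := par x with ht
          have hct : c x = s t • c (act t x) := by rw [hcdef x, if_pos hlt]
          by_cases hat : a = t
          · rw [hat, hct, smul_smul, hinv t htJ, one_smul]
          obtain ⟨hm, hwalk⟩ := (hall a ha hat).resolve_left (by omega)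
          obtain ⟨m', hm'⟩ : ∃ m', m a t = m' + 2 := ⟨m a t - 2, by omega⟩
          rw [hm'] at hwalk
          have hit : ∀ j ≤ m', (act t ∘ act a)^[j] (act t x) ∈ L ∧
              c ((act t ∘ act a)^[j] (act t x)) = (s t * s a) ^ j • c (act t x) := by
            intro j
            induction j with
            | zero => intro _; exact ⟨hL t htJ x hx, by simp⟩
            | succ j ihj =>
              intro hj
              obtain ⟨hj1, hj2⟩ := ihj (by omega)
              have hw := hwalk j (by omega)
              have hw' := hwalk (j + 1) (by omega)
              rw [Function.iterate_succ_apply'] at hw' ⊢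
              refine ⟨hL t htJ _ (hL a ha _ hj1), ?_⟩
              rw [Function.comp_apply] at hw' ⊢
              rw [← ih _ (hL a ha _ hj1) (by omega) t htJ (by omega),
                ← ih _ hj1 (by omega) a ha (by omega), hj2, smul_smul, smul_smul, pow_succ',
                mul_assoc]
          obtain ⟨hz1, hz2⟩ := hit m' le_rfl
          have hw := hwalk m' (by omega)
          set y := (act t ∘ act a)^[m'] (act t x) with hy
          have hbraid := braid_of_pow_eq_one (hinv a ha) (hinv t htJ) (hm' ▸ hrel a ha t htJ)
          have hyx : act t (act a y) = act a x := by
            have hyφ : ∀ j, (act t ∘ act a)^[j] (act t x) = φ ((s t * s a) ^ j * s t) x := by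
              intro j
              induction j with
              | zero => simp [hφ t htJ]
              | succ j ihj =>
                rw [Function.iterate_succ_apply', ihj, Function.comp_apply, ← hφ t htJ,
                  ← hφ a ha, ← Equiv.Perm.mul_apply, ← Equiv.Perm.mul_apply, ← map_mul, ← map_mul,
                  pow_succ', mul_assoc, mul_assoc, mul_assoc]
            rw [hy, hyφ, ← hφ t htJ, ← hφ a ha, ← hφ a ha, ← Equiv.Perm.mul_apply,
              ← Equiv.Perm.mul_apply, ← map_mul, ← map_mul]
            exact congrArg (fun g => φ g x) (by simpa only [mul_assoc] using hbraid)
          have hcz : s a • c x = s t • c (act a y) := by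
            rw [← ih y hz1 (by omega) a ha (by omega), hz2, hct, smul_smul, smul_smul, smul_smul]
            congr 1
            calc s a * s t = s t * s a * (s t * s a) ^ m' * s t * s t := by rw [hbraid]
              _ = s t * s a * (s t * s a) ^ m' := by
                rw [mul_assoc _ (s t), hinv t htJ, mul_one]
          rw [hcz, ← hyx]
          rcases hax.lt_or_eq with hlt' | heq
          · exact ih _ (hL a ha _ hz1) (by omega) t htJ (by rw [hyx]; exact hlt')
          · have hfx : act a x = x := hinj _ (hL a ha x hx) _ hx (by omega)
            have : act a y = act t x := by rw [← hact t htJ (act a y), hyx, hfx]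
            rw [this, ← hct, hact t htJ]
      intro x hx hxN a ha haN
      rcases (Nat.lt_succ_iff.1 hxN).lt_or_eq with h1 | h1
      · rcases (Nat.lt_succ_iff.1 haN).lt_or_eq with h2 | h2
        · exact ih x hx h1 a ha h2
        · have := top _ (hL a ha x hx) h2 a ha (by rw [hact a ha]; omega)
          rw [hact a ha] at this
          rw [← this, smul_smul, hinv a ha, one_smul]
      · exact top x hx h1 a ha (by omega)
  exact fun x hx a ha => key (max (h x) (h (act a x)) + 1) x hx (by omega) a ha (by omega)

/-- The subgroup generated by the `s a`, `a ∈ J`. Subsets of the generators are lists here, because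
conditions on them are to be evaluated. -/
def parabolic {κ G : Type*} [Group G] (s : κ → G) (J : List κ) : Subgroup G :=
  Subgroup.closure (s '' {a | a ∈ J})

theorem mem_parabolic_of_mem {κ G : Type*} [Group G] (s : κ → G) {J : List κ} {a : κ}
    (ha : a ∈ J) : s a ∈ parabolic s J :=
  Subgroup.subset_closure ⟨a, ha, rfl⟩

theorem parabolic_induction {κ G : Type*} [Group G] {s : κ → G} {J : List κ}
    (hinv : ∀ a ∈ J, s a * s a = 1) {p : G → Prop} (one : p 1)
    (mul : ∀ a ∈ J, ∀ g, p g → p (s a * g)) {g : G} (hg : g ∈ parabolic s J) : p g := by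
  induction hg using Subgroup.closure_induction_left with
  | one => exact one
  | mul_left x hx y _ hy =>
    obtain ⟨a, ha, rfl⟩ := hx
    exact mul a ha y hy
  | inv_mul_cancel x hx y _ hy =>
    obtain ⟨a, ha, rfl⟩ := hx
    rw [inv_eq_of_mul_eq_one_left (hinv a ha)]
    exact mul a ha y hy

variable [DecidableEq κ]

/-- The stabilizer of `b` in the parabolic subgroup is generated by the generators that fix `b`. -/
theorem DescentCheck.mem_parabolic (hc : DescentCheck act m J k b L h)
    (hrel : ∀ a ∈ J, ∀ t ∈ J, (s a * s t) ^ m a t = 1) (hinv : ∀ a ∈ J, s a * s a = 1)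
    (hφ : ∀ a ∈ J, ∀ x, φ (s a) x = act a x) (hmem : ∀ y, h y < L.length → y ∈ L)
    {g : G} (hg : g ∈ parabolic s J) (hgb : φ g b = b) : g ∈ parabolic s (J.filter (· ≠ k)) := by
  obtain ⟨c, hcb, hcL⟩ := hc.exists_label hrel hinv hφ hmem (parabolic s (J.filter (· ≠ k)))
    fun a ha hak => mem_parabolic_of_mem s (by simp [ha, hak])
  obtain ⟨hb, hfix, hrange, hpos, hstep⟩ := hc
  have key : φ g b ∈ L ∧ (g : G ⧸ parabolic s (J.filter (· ≠ k))) = c (φ g b) := by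
    refine parabolic_induction (p := fun g => φ g b ∈ L ∧
      (g : G ⧸ parabolic s (J.filter (· ≠ k))) = c (φ g b)) hinv ?_ ?_ hg
    · simp [hcb, hmem b (hb ▸ hpos)]
    · rintro a ha g ⟨h1, h2⟩
      rw [map_mul, Equiv.Perm.mul_apply, hφ a ha, ← hcL _ h1 a ha, ← h2]
      exact ⟨hmem _ ((hstep _ h1).1 a ha), rfl⟩
  rw [hgb, hcb] at key
  have := (QuotientGroup.eq (s := parabolic s (J.filter (· ≠ k)))).1 key.2
  simpa using this

theorem DescentCheck.apply_eq (hc : DescentCheck act m J k b L h)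
    (hinv : ∀ a ∈ J, s a * s a = 1) (hφ : ∀ a ∈ J, ∀ x, φ (s a) x = act a x)
    {g : G} (hg : g ∈ parabolic s (J.filter (· ≠ k))) : φ g b = b := by
  refine parabolic_induction (p := fun g => φ g b = b) (fun a ha => hinv a ?_) (by simp) ?_ hg
  · exact (List.mem_filter.1 ha).1
  · intro a ha g hgb
    obtain ⟨h1, h2⟩ := List.mem_filter.1 ha
    rw [map_mul, Equiv.Perm.mul_apply, hgb, hφ a h1, (hc.2.1 a h1).2 (by simpa using h2)]

theorem DescentCheck.card_parabolic (hc : DescentCheck act m J k b L h)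
    (hrel : ∀ a ∈ J, ∀ t ∈ J, (s a * s t) ^ m a t = 1) (hinv : ∀ a ∈ J, s a * s a = 1)
    (hφ : ∀ a ∈ J, ∀ x, φ (s a) x = act a x) (hmem : ∀ y, h y < L.length → y ∈ L) :
    Nat.card (parabolic s J) = L.length * Nat.card (parabolic s (J.filter (· ≠ k))) := by
  classical
  let φ' : parabolic s J →* Equiv.Perm X := φ.comp (parabolic s J).subtype
  let _ : MulAction (parabolic s J) X := MulAction.compHom X φ'
  have hsmul : ∀ (g : parabolic s J) (x : X), g • x = φ g x := fun _ _ => rfl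
  have hle : parabolic s (J.filter (· ≠ k)) ≤ parabolic s J :=
    Subgroup.closure_mono (Set.image_mono fun a ha => (List.mem_filter.1 ha).1)
  have hstab : MulAction.stabilizer (parabolic s J) b =
      (parabolic s (J.filter (· ≠ k))).subgroupOf (parabolic s J) := by
    ext g
    rw [MulAction.mem_stabilizer_iff, Subgroup.mem_subgroupOf, hsmul]
    exact ⟨fun hg => hc.mem_parabolic hrel hinv hφ hmem g.2 hg, hc.apply_eq hinv hφ⟩
  have horb : MulAction.orbit (parabolic s J) b = (L.toFinset : Set X) := by
    obtain ⟨hb, hfix, hrange, hpos, hstep⟩ := hc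
    have hinj : ∀ x ∈ L, ∀ y ∈ L, h x = h y → x = y := fun x hx y hy hxy =>
      List.inj_on_of_nodup_map (f := h) (hrange ▸ List.nodup_range) hx hy hxy
    have hbL : b ∈ L := hmem b (hb ▸ hpos)
    ext x
    rw [List.coe_toFinset, Set.mem_ofPred_eq]
    constructor
    · rintro ⟨g, rfl⟩
      change φ (g : G) b ∈ L
      refine parabolic_induction (p := fun g => φ g b ∈ L) hinv (by simpa using hbL) ?_ g.2
      intro a ha g hg
      rw [map_mul, Equiv.Perm.mul_apply, hφ a ha]
      exact hmem _ ((hstep _ hg).1 a ha)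
    · induction hx : h x using Nat.strong_induction_on generalizing x with
      | _ N ih =>
        intro hxL
        rcases (hstep x hxL).2 with h0 | ⟨t, ht, hlt, -⟩
        · obtain rfl : x = b := hinj _ hxL _ hbL (h0.trans hb.symm)
          exact MulAction.mem_orbit_self _
        · obtain ⟨g, hg⟩ := ih _ (hx ▸ hlt) (act t x) rfl (hmem _ ((hstep x hxL).1 t ht))
          refine ⟨⟨s t, mem_parabolic_of_mem s ht⟩ * g, ?_⟩
          change φ g b = act t x at hg
          change φ (s t * g) b = x
          rw [map_mul, Equiv.Perm.mul_apply, hg, ← hφ t ht, ← Equiv.Perm.mul_apply, ← map_mul,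
            hinv t ht, map_one, Equiv.Perm.one_apply]
  rw [← Subgroup.card_mul_index (MulAction.stabilizer (parabolic s J) b),
    MulAction.index_stabilizer, horb, Set.ncard_coe_finset, List.toFinset_card_of_nodup,
    mul_comm, hstab, Nat.card_congr (Subgroup.subgroupOfEquivOfLe hle).toEquiv]
  exact List.Nodup.of_map h (hc.2.2.1 ▸ List.nodup_range)

end Descent

/-! ### The reflection representation over the field with 31 elements -/

section Reflection

variable {A : Type*} [CommRing A]

/-- The `a`-th simple reflection of a string Coxeter group of rank 4 in the coordinates with
respect to the fundamental weights; `c k` stands for `2 cos (π / m)`, where `m` is the order of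
`ρ k * ρ (k + 1)`. -/
def reflect (c : Fin 3 → A) (a : Fin 4) (x : A × A × A × A) : A × A × A × A :=
  match a with
  | 0 => (-x.1, x.2.1 + c 0 * x.1, x.2.2.1, x.2.2.2)
  | 1 => (x.1 + c 0 * x.2.1, -x.2.1, x.2.2.1 + c 1 * x.2.1, x.2.2.2)
  | 2 => (x.1, x.2.1 + c 1 * x.2.2.1, -x.2.2.1, x.2.2.2 + c 2 * x.2.2.1)
  | 3 => (x.1, x.2.1, x.2.2.1 + c 2 * x.2.2.2, -x.2.2.2)

theorem reflect_involutive (c : Fin 3 → A) (a : Fin 4) : Function.Involutive (reflect c a) := by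
  intro x
  fin_cases a <;> simp [reflect]

theorem reflect_iterate_adjacent (c : Fin 3 → A) (k : Fin 3) (m : ℕ)
    (h : m = 3 ∧ c k = 1 ∨ m = 4 ∧ c k ^ 2 = 2 ∨ m = 5 ∧ c k ^ 2 = c k + 1)
    (x : A × A × A × A) : (reflect c k.castSucc ∘ reflect c k.succ)^[m] x = x := by
  obtain ⟨x, y, z, w⟩ := x
  fin_cases k <;> obtain ⟨rfl, h⟩ | ⟨rfl, h⟩ | ⟨rfl, h⟩ := h <;>
  simp only [Function.iterate_succ, Function.iterate_zero, Function.comp_apply, reflect, id,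
    Prod.mk.injEq, Fin.reduceFinMk, Fin.reduceSucc, Fin.reduceCastSucc] at h ⊢ <;>
  refine ⟨?_, ?_, ?_, ?_⟩ <;> grind

theorem reflect_comm (c : Fin 3 → A) (a b : Fin 4) (h : (a : ℕ) + 2 ≤ b) (x : A × A × A × A) :
    reflect c a (reflect c b x) = reflect c b (reflect c a x) := by
  fin_cases a <;> fin_cases b <;> simp at h <;> simp [reflect, add_right_comm]

end Reflection

/-- Vectors over the field with 31 elements, which contains the square root `8` of `2` and the
golden ratio `19`; the four coordinates refer to the fundamental weights. -/
abbrev Weight : Type := ZMod 31 × ZMod 31 × ZMod 31 × ZMod 31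

/-- The value of `2 cos (π / m)` in `ZMod 31`, for `m = 3, 4, 5`. -/
def bond : ℕ → ZMod 31
  | 4 => 8
  | 5 => 19
  | _ => 1

/-- The `a`-th simple reflection of the Coxeter group of `P_i`. -/
def reflectWeight (i : Convex4) : Fin 4 → Weight → Weight :=
  reflect fun k => bond (schlafli i k)

/-- The `a`-th simple reflection as a permutation. -/
def weightPerm (i : Convex4) (a : Fin 4) : Equiv.Perm Weight :=
  (reflect_involutive (fun k => bond (schlafli i k)) a).toPerm

theorem weightPerm_apply (i : Convex4) (a : Fin 4) (x : Weight) :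
    weightPerm i a x = reflectWeight i a x := rfl

theorem weightPerm_mul_self (i : Convex4) (a : Fin 4) : weightPerm i a * weightPerm i a = 1 :=
  Equiv.ext fun x => reflect_involutive _ a x

theorem mul_pow_eq_one_comm {G : Type*} [Group G] {a b : G} {n : ℕ} (h : (a * b) ^ n = 1) :
    (b * a) ^ n = 1 := by
  rw [show b * a = b * (a * b) * b⁻¹ by group, conj_pow, h, mul_one, mul_inv_cancel]

theorem weightPerm_liftable (i : Convex4) : (coxeterMatrix i).IsLiftable (weightPerm i) := by
  have hadj : ∀ k : Fin 3,
      (weightPerm i k.castSucc * weightPerm i k.succ) ^ schlafli i k = 1 := by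
    intro k
    ext1 x
    rw [Equiv.Perm.coe_pow, Equiv.Perm.coe_mul]
    refine reflect_iterate_adjacent _ k _ ?_ x
    revert i k; decide
  have hfar : ∀ a b : Fin 4, (a : ℕ) + 2 ≤ b → (weightPerm i a * weightPerm i b) ^ 2 = 1 := by
    intro a b hab
    have hcomm : weightPerm i a * weightPerm i b = weightPerm i b * weightPerm i a :=
      Equiv.ext fun x => reflect_comm _ a b hab x
    rw [pow_two]
    nth_rewrite 2 [hcomm]
    rw [mul_assoc, ← mul_assoc (weightPerm i b), weightPerm_mul_self, one_mul,
      weightPerm_mul_self]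
  intro a b
  rcases lt_trichotomy a b with hab | rfl | hab
  · fin_cases a <;> fin_cases b <;> first
      | exact absurd hab (by decide) | exact hadj 0 | exact hadj 1 | exact hadj 2
      | exact hfar _ _ (by decide)
  · rw [(coxeterMatrix i).diagonal, pow_one, weightPerm_mul_self]
  · apply mul_pow_eq_one_comm
    fin_cases a <;> fin_cases b <;> first
      | exact absurd hab (by decide) | exact hadj 0 | exact hadj 1 | exact hadj 2
      | exact hfar _ _ (by decide)

/-- The fundamental weights, which are the basis vectors. -/
def fundamentalWeight : Fin 4 → Weight
  | 0 => (1, 0, 0, 0)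
  | 1 => (0, 1, 0, 0)
  | 2 => (0, 0, 1, 0)
  | 3 => (0, 0, 0, 1)

/-! ### Orbits of fundamental weights -/

/-- A number that encodes a weight; comparing numbers keeps the evaluation of `DescentCheck` fast.
-/
def weightCode (x : Weight) : ℕ :=
  x.1.val + 31 * (x.2.1.val + 31 * (x.2.2.1.val + 31 * x.2.2.2.val))

theorem weightCode_injective : Function.Injective weightCode := by
  rintro ⟨x, y, z, w⟩ ⟨x', y', z', w'⟩ h
  simp only [weightCode] at h
  have := x.val_lt; have := x'.val_lt; have := y.val_lt; have := y'.val_lt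
  have := z.val_lt; have := z'.val_lt
  rw [ZMod.val_injective 31 (show x.val = x'.val by omega),
    ZMod.val_injective 31 (show y.val = y'.val by omega),
    ZMod.val_injective 31 (show z.val = z'.val by omega),
    ZMod.val_injective 31 (show w.val = w'.val by omega)]

/-- The index of the first occurrence of `n` in a list, or the length of the list. -/
def position : List ℕ → ℕ → ℕ
  | [], _ => 0
  | c :: l, n => bif Nat.beq c n then 0 else position l n + 1

theorem mem_of_position_lt {l : List ℕ} {n : ℕ} (h : position l n < l.length) : n ∈ l := by
  induction l with
  | nil => simp at h
  | cons c l ih =>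
    rw [position] at h
    cases hc : Nat.beq c n with
    | true => simp [Nat.eq_of_beq_eq_true hc]
    | false =>
      rw [hc, cond_false, List.length_cons] at h
      exact List.mem_cons_of_mem _ (ih (by omega))

/-- The index of a weight in a list of weights. -/
def height (L : List Weight) (x : Weight) : ℕ := position (L.map weightCode) (weightCode x)

theorem mem_of_height_lt {L : List Weight} {x : Weight} (h : height L x < L.length) : x ∈ L := by
  have : weightCode x ∈ L.map weightCode := mem_of_position_lt (by rwa [List.length_map])
  obtain ⟨y, hy, hxy⟩ := List.mem_map.1 this
  rwa [← weightCode_injective hxy]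

/-- The list `L` of weights, prolonged by the new neighbours of the weights in `front`, and so on
for `n` rounds. -/
def growOrbit (i : Convex4) (J : List (Fin 4)) : ℕ → List Weight → List Weight → List Weight
  | 0, _, L => L
  | n + 1, front, L =>
    let L' := (front.flatMap fun x => J.map fun a => reflectWeight i a x).foldl
      (fun M y => bif Nat.blt (height M y) M.length then M else M ++ [y]) L
    growOrbit i J n (L'.drop L.length) L'

/-- The orbit of the `k`-th fundamental weight under the simple reflections in `J`, in breadth-first
order. As many rounds are needed as the longest of the shortest representatives of the cosets of
the stabilizer has letters. For the orbits in use this is at most `45 = 60 - 15`, the value for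
`[5, 3, 3]` modulo `[5, 3]`. -/
def weightOrbit (i : Convex4) (J : List (Fin 4)) (k : Fin 4) : List Weight :=
  growOrbit i J 45 [fundamentalWeight k] [fundamentalWeight k]

/-- The end of the Coxeter diagram at which the orbit of the fundamental weight under the whole
group is smallest. This is the only orbit under the whole group that has to be enumerated. -/
def apex : Convex4 → Fin 4
  | .P₅ | .P₆ => 3
  | _ => 0

set_option maxRecDepth 100000 in
theorem weightOrbit_descentCheck : ∀ i : Convex4, ∀ J ∈ [0, 1, 2, 3].sublists, ∀ k ∈ J,
    (J = [0, 1, 2, 3] → k = apex i) →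
    DescentCheck (reflectWeight i) (fun a b => coxeterMatrix i a b) J k (fundamentalWeight k)
      (weightOrbit i J k) (height (weightOrbit i J k)) := by
  decide +kernel

/-! ### Parabolic subgroups -/

/-- The elements `s a`, `a ∈ J`, of `G` satisfy the Coxeter relations of `P_i` and act on the
weights, via `φ`, as the simple reflections. -/
structure IsWeightAction (i : Convex4) (J : List (Fin 4)) {G : Type*} [Group G] (s : Fin 4 → G)
    (φ : G →* Equiv.Perm Weight) : Prop where
  rel : ∀ a ∈ J, ∀ t ∈ J, (s a * s t) ^ coxeterMatrix i a t = 1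
  apply : ∀ a ∈ J, φ (s a) = weightPerm i a

namespace IsWeightAction

variable {i : Convex4} {J : List (Fin 4)} {G : Type*} [Group G] {s : Fin 4 → G}
  {φ : G →* Equiv.Perm Weight}

theorem mono (h : IsWeightAction i J s φ) {J' : List (Fin 4)} (hJ : J' ⊆ J) :
    IsWeightAction i J' s φ :=
  ⟨fun a ha t ht => h.rel a (hJ ha) t (hJ ht), fun a ha => h.apply a (hJ ha)⟩

theorem mul_self (h : IsWeightAction i J s φ) (a : Fin 4) (ha : a ∈ J) : s a * s a = 1 := by
  simpa [(coxeterMatrix i).diagonal] using h.rel a ha a ha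

theorem apply_apply (h : IsWeightAction i J s φ) (a : Fin 4) (ha : a ∈ J) (x : Weight) :
    φ (s a) x = reflectWeight i a x := by rw [h.apply a ha, weightPerm_apply]

/-- The stabilizer of the `k`-th fundamental weight in a parabolic subgroup. -/
theorem mem_parabolic_filter (h : IsWeightAction i J s φ) (hJ : J.Sublist [0, 1, 2, 3]) {k : Fin 4}
    (hk : k ∈ J) (hik : J = [0, 1, 2, 3] → k = apex i) {g : G} (hg : g ∈ parabolic s J)
    (hgk : φ g (fundamentalWeight k) = fundamentalWeight k) :
    g ∈ parabolic s (J.filter (· ≠ k)) :=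
  (weightOrbit_descentCheck i J (List.mem_sublists.2 hJ) k hk hik).mem_parabolic h.rel h.mul_self
    h.apply_apply (fun _ => mem_of_height_lt) hg hgk

theorem card_parabolic (h : IsWeightAction i J s φ) (hJ : J.Sublist [0, 1, 2, 3]) {k : Fin 4}
    (hk : k ∈ J) (hik : J = [0, 1, 2, 3] → k = apex i) :
    Nat.card (parabolic s J) =
      (weightOrbit i J k).length * Nat.card (parabolic s (J.filter (· ≠ k))) :=
  (weightOrbit_descentCheck i J (List.mem_sublists.2 hJ) k hk hik).card_parabolic h.rel h.mul_self
    h.apply_apply (fun _ => mem_of_height_lt)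

theorem mem_parabolic_of_forall (h : IsWeightAction i J s φ) (hJ : J.Sublist [0, 1, 2, 3])
    (hJ4 : J.length < 4) (T : List (Fin 4)) {g : G} (hg : g ∈ parabolic s J)
    (hgT : ∀ k ∈ T, φ g (fundamentalWeight k) = fundamentalWeight k) :
    g ∈ parabolic s (J.filter (· ∉ T)) := by
  induction T with
  | nil => simpa using hg
  | cons k T ih =>
    have hg' := ih fun l hl => hgT l (List.mem_cons_of_mem _ hl)
    have hfilter : J.filter (· ∉ k :: T) = (J.filter (· ∉ T)).filter (· ≠ k) := by
      rw [List.filter_filter]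
      congr 1
      ext a
      simp
    rw [hfilter]
    by_cases hk : k ∈ J.filter (· ∉ T)
    · refine (h.mono (List.filter_subset_self _)).mem_parabolic_filter
        (List.filter_sublist.trans hJ) hk (fun hfull => ?_) hg' (hgT k List.mem_cons_self)
      have := congrArg List.length hfull
      have := List.length_filter_le (fun a => decide (a ∉ T)) J
      simp at *
      omega
    · rwa [List.filter_eq_self.2]
      intro a ha
      simpa using fun hak : a = k => hk (hak ▸ ha)

/-- An element of a proper parabolic subgroup that acts trivially is trivial. -/
theorem eq_one_of_apply_eq_one (h : IsWeightAction i J s φ) (hJ : J.Sublist [0, 1, 2, 3])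
    (hJ4 : J.length < 4) {g : G} (hg : g ∈ parabolic s J) (hφ : φ g = 1) : g = 1 := by
  have := h.mem_parabolic_of_forall hJ hJ4 J hg fun k _ => by rw [hφ]; rfl
  simpa [parabolic] using this

end IsWeightAction

/-- The order of the parabolic subgroup on `J`, as a product of lengths of orbits. -/
def parabolicOrder (i : Convex4) : List (Fin 4) → ℕ
  | [] => 1
  | k :: J => (weightOrbit i (k :: J) k).length * parabolicOrder i J

theorem IsWeightAction.card_parabolic_eq {i : Convex4} {J : List (Fin 4)} {G : Type*} [Group G]
    {s : Fin 4 → G} {φ : G →* Equiv.Perm Weight} (h : IsWeightAction i J s φ)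
    (hJ : J.Sublist [0, 1, 2, 3]) (hi : J = [0, 1, 2, 3] → apex i = 0) :
    Nat.card (parabolic s J) = parabolicOrder i J := by
  induction J with
  | nil => simp [parabolic, parabolicOrder]
  | cons k J ih =>
    have hnodup : (k :: J).Nodup := hJ.nodup (by decide)
    have hfilter : (k :: J).filter (· ≠ k) = J := by
      rw [List.filter_cons_of_neg (by simp), List.filter_eq_self]
      intro a ha
      simpa using fun hak : a = k => (List.nodup_cons.1 hnodup).1 (hak ▸ ha)
    rw [h.card_parabolic hJ List.mem_cons_self fun hfull => by
      rw [hi hfull]; exact (List.cons.inj hfull).1, hfilter, parabolicOrder,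
      ih (h.mono (List.subset_cons_self _ _)) ((List.sublist_cons_self _ _).trans hJ)]
    rintro rfl
    simpa using hJ.length_le

/-! ### The six Coxeter groups -/

/-- The Coxeter group of `P_i`. -/
abbrev CoxGroup (i : Convex4) : Type := (coxeterMatrix i).Group

/-- The generating reflections. -/
abbrev rho (i : Convex4) (a : Fin 4) : CoxGroup i := (coxeterMatrix i).simple a

theorem rho_mul_pow (i : Convex4) (a b : Fin 4) : (rho i a * rho i b) ^ coxeterMatrix i a b = 1 :=
  (coxeterMatrix i).toCoxeterSystem.simple_mul_simple_pow a b

theorem rho_mul_self (i : Convex4) (a : Fin 4) : rho i a * rho i a = 1 := by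
  simpa [(coxeterMatrix i).diagonal] using rho_mul_pow i a a

theorem closure_range_rho (i : Convex4) : Subgroup.closure (Set.range (rho i)) = ⊤ :=
  (coxeterMatrix i).toCoxeterSystem.subgroup_closure_range_simple

/-- The action of the Coxeter group on the weights. -/
def weightHom (i : Convex4) : CoxGroup i →* Equiv.Perm Weight :=
  (coxeterMatrix i).toCoxeterSystem.lift ⟨weightPerm i, weightPerm_liftable i⟩

theorem weightHom_rho (i : Convex4) (a : Fin 4) : weightHom i (rho i a) = weightPerm i a :=
  (coxeterMatrix i).toCoxeterSystem.lift_apply_simple (weightPerm_liftable i) a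

theorem isWeightAction_weightHom (i : Convex4) (J : List (Fin 4)) :
    IsWeightAction i J (rho i) (weightHom i) :=
  ⟨fun a _ t _ => rho_mul_pow i a t, fun a _ => weightHom_rho i a⟩

theorem fundamentalWeight_fixed (i : Convex4) {a k : Fin 4} :
    reflectWeight i a (fundamentalWeight k) = fundamentalWeight k ↔ a ≠ k := by
  revert i a k; decide +kernel

theorem weightHom_fundamentalWeight {i : Convex4} {k : Fin 4} {g : CoxGroup i}
    (hg : g ∈ Subgroup.closure (rho i '' {k}ᶜ)) :
    weightHom i g (fundamentalWeight k) = fundamentalWeight k := by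
  induction hg using Subgroup.closure_induction with
  | mem x hx =>
    obtain ⟨a, ha, rfl⟩ := hx
    rw [weightHom_rho, weightPerm_apply, fundamentalWeight_fixed]
    exact ha
  | one => simp
  | mul x y _ _ hx hy => rw [map_mul, Equiv.Perm.mul_apply, hy, hx]
  | inv x _ hx => rw [map_inv, Equiv.Perm.inv_eq_iff_eq, hx]

theorem rho_notMem (i : Convex4) (k : Fin 4) : rho i k ∉ Subgroup.closure (rho i '' {k}ᶜ) := by
  intro h
  have := weightHom_fundamentalWeight h
  rw [weightHom_rho, weightPerm_apply, fundamentalWeight_fixed] at this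
  exact this rfl

/-- The intersection property of the Coxeter group of `P_i`. -/
theorem mem_closure_rho_of_forall {i : Convex4} {J : Set (Fin 4)} {g : CoxGroup i}
    (hg : ∀ k ∉ J, g ∈ Subgroup.closure (rho i '' {k}ᶜ)) : g ∈ Subgroup.closure (rho i '' J) := by
  classical
  by_cases hJ : J = Set.univ
  · rw [hJ, Set.image_univ, closure_range_rho]; trivial
  obtain ⟨a, ha⟩ := (Set.ne_univ_iff_exists_notMem J).1 hJ
  have hset : ∀ L : List (Fin 4), ∀ K : Set (Fin 4), (∀ x, x ∈ L ↔ x ∈ K) →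
      parabolic (rho i) L = Subgroup.closure (rho i '' K) := fun L K h => by
    rw [parabolic, show {a | a ∈ L} = K from Set.ext h]
  have key := (isWeightAction_weightHom i
    (([0, 1, 2, 3] : List (Fin 4)).filter (· ≠ a))).mem_parabolic_of_forall List.filter_sublist
    (by clear * -; revert a; decide) (([0, 1, 2, 3] : List (Fin 4)).filter (· ∉ J)) (g := g)
    (by rw [hset _ {a}ᶜ]; exact hg a ha; intro x; fin_cases x <;> simp)
    fun k hk => weightHom_fundamentalWeight (hg k (by simpa using (List.mem_filter.1 hk).2))
  rwa [hset _ J] at key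
  intro x
  have hx : x ∈ ([0, 1, 2, 3] : List (Fin 4)) := by revert x; decide
  by_cases hxJ : x ∈ J
  · simpa only [List.mem_filter, hx, hxJ, decide_eq_true_eq, true_and, not_true, and_false,
      not_false_iff, and_true, iff_true] using fun hxa : x = a => ha (hxa ▸ hxJ)
  · simp only [List.mem_filter, hx, hxJ, decide_eq_true_eq, true_and, not_false_iff, not_true,
      and_false]

theorem card_parabolic_rho (i : Convex4) {J : List (Fin 4)} (hJ : J.Sublist [0, 1, 2, 3])
    (hi : J = [0, 1, 2, 3] → apex i = 0) :
    Nat.card (parabolic (rho i) J) = parabolicOrder i J :=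
  (isWeightAction_weightHom i J).card_parabolic_eq hJ hi

/-- The order of the Coxeter group of `P_i`. -/
def coxOrder : Convex4 → ℕ
  | .P₁ => 120
  | .P₂ | .P₅ => 384
  | .P₃ | .P₆ => 14400
  | .P₄ => 1152

set_option maxRecDepth 100000 in
theorem parabolicOrder_univ (i : Convex4) :
    if apex i = 0 then parabolicOrder i [0, 1, 2, 3] = coxOrder i else
      (weightOrbit i [0, 1, 2, 3] 3).length * parabolicOrder i [0, 1, 2] = coxOrder i := by
  revert i; decide +kernel

theorem apex_eq (i : Convex4) : apex i = 0 ∨ apex i = 3 := by revert i; decide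

theorem card_coxGroup (i : Convex4) : Nat.card (CoxGroup i) = coxOrder i := by
  have htop : parabolic (rho i) [0, 1, 2, 3] = ⊤ := by
    rw [parabolic, ← closure_range_rho, ← Set.image_univ]
    congr 2
    ext x; fin_cases x <;> simp
  rw [← Subgroup.card_top, ← htop]
  have := parabolicOrder_univ i
  split_ifs at this with h
  · rw [card_parabolic_rho i (List.Sublist.refl _) fun _ => h, this]
  · rw [(isWeightAction_weightHom i _).card_parabolic (List.Sublist.refl _) (k := 3) (by decide)
      fun _ => (apex_eq i).resolve_left h ▸ rfl, ← this,
      ← card_parabolic_rho i (by decide) (by simp)]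
    rfl

/-! ### Reflections and rotations -/

section Even

variable {κ E : Type*} [Group E]

/-- The subgroup generated by the `α a` with `a ∈ J`. -/
def reflGroup (α : κ → E) (J : Set κ) : Subgroup E := Subgroup.closure (α '' J)

/-- The subgroup generated by the products of two of the `α a` with `a ∈ J`. -/
def evenGroup (α : κ → E) (J : Set κ) : Subgroup E :=
  Subgroup.closure {g | ∃ a ∈ J, ∃ b ∈ J, g = α a * α b}

variable {α : κ → E} {J K : Set κ}

theorem mem_reflGroup {a : κ} (ha : a ∈ J) : α a ∈ reflGroup α J :=
  Subgroup.subset_closure ⟨a, ha, rfl⟩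

theorem mul_mem_evenGroup {a b : κ} (ha : a ∈ J) (hb : b ∈ J) : α a * α b ∈ evenGroup α J :=
  Subgroup.subset_closure ⟨a, ha, b, hb, rfl⟩

theorem reflGroup_mono (h : J ⊆ K) : reflGroup α J ≤ reflGroup α K :=
  Subgroup.closure_mono (Set.image_mono h)

theorem evenGroup_le_reflGroup : evenGroup α J ≤ reflGroup α J := by
  rw [evenGroup, Subgroup.closure_le]
  rintro _ ⟨a, ha, b, hb, rfl⟩
  exact mul_mem (mem_reflGroup ha) (mem_reflGroup hb)

theorem map_reflGroup {E' : Type*} [Group E'] (f : E →* E') :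
    (reflGroup α J).map f = reflGroup (fun a => f (α a)) J := by
  rw [reflGroup, reflGroup, MonoidHom.map_closure, ← Set.image_comp]; rfl

theorem map_evenGroup {E' : Type*} [Group E'] (f : E →* E') :
    (evenGroup α J).map f = evenGroup (fun a => f (α a)) J := by
  rw [evenGroup, evenGroup, MonoidHom.map_closure]
  congr 1
  ext g
  constructor
  · rintro ⟨_, ⟨a, ha, b, hb, rfl⟩, rfl⟩
    exact ⟨a, ha, b, hb, map_mul ..⟩
  · rintro ⟨a, ha, b, hb, rfl⟩
    exact ⟨_, ⟨a, ha, b, hb, rfl⟩, map_mul ..⟩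

theorem evenGroup_image {κ' : Type*} (f : κ' → κ) (J : Set κ') :
    evenGroup α (f '' J) = evenGroup (α ∘ f) J := by
  rw [evenGroup, evenGroup]
  congr 1
  ext g
  simp

theorem reflGroup_induction_right (hα : ∀ a, α a * α a = 1) {p : E → Prop} (one : p 1)
    (mul : ∀ g ∈ reflGroup α J, ∀ a ∈ J, p g → p (g * α a)) {g : E} (hg : g ∈ reflGroup α J) :
    p g := by
  induction hg using Subgroup.closure_induction_right with
  | one => exact one
  | mul_right x hx y hy hp =>
    obtain ⟨a, ha, rfl⟩ := hy
    exact mul x hx a ha hp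
  | mul_inv_cancel x hx y hy hp =>
    obtain ⟨a, ha, rfl⟩ := hy
    rw [inv_eq_of_mul_eq_one_left (hα a)]
    exact mul x hx a ha hp

theorem mem_evenGroup_or (hα : ∀ a, α a * α a = 1) {j : κ} (hj : j ∈ J) {g : E}
    (hg : g ∈ reflGroup α J) : g ∈ evenGroup α J ∨ g * α j ∈ evenGroup α J := by
  refine reflGroup_induction_right (p := fun g => g ∈ evenGroup α J ∨ g * α j ∈ evenGroup α J) hα
    (.inl (one_mem _)) (fun g _ a ha h => ?_) hg
  rcases h with h | h
  · right
    rw [mul_assoc]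
    exact mul_mem h (mul_mem_evenGroup ha hj)
  · left
    have := mul_mem h (mul_mem_evenGroup (α := α) hj ha)
    rwa [mul_assoc, ← mul_assoc (α j), hα, one_mul] at this

theorem sign_of_mem_evenGroup {ε : E →* ℤˣ} (hε : ∀ a, ε (α a) = -1) {g : E}
    (hg : g ∈ evenGroup α J) : ε g = 1 := by
  induction hg using Subgroup.closure_induction with
  | mem x hx => obtain ⟨a, _, b, _, rfl⟩ := hx; simp [hε]
  | one => simp
  | mul x y _ _ hx hy => simp [hx, hy]
  | inv x _ hx => simp [hx]

theorem mem_evenGroup_iff (hα : ∀ a, α a * α a = 1) {ε : E →* ℤˣ} (hε : ∀ a, ε (α a) = -1)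
    {g : E} : g ∈ evenGroup α J ↔ g ∈ reflGroup α J ∧ ε g = 1 := by
  refine ⟨fun h => ⟨evenGroup_le_reflGroup h, sign_of_mem_evenGroup hε h⟩, fun ⟨h, hg⟩ => ?_⟩
  rcases J.eq_empty_or_nonempty with rfl | ⟨j, hj⟩
  · rw [reflGroup, Set.image_empty, Subgroup.closure_empty, Subgroup.mem_bot] at h
    exact h ▸ one_mem _
  · refine (mem_evenGroup_or hα hj h).resolve_right fun h' => ?_
    have := sign_of_mem_evenGroup hε h'
    rw [map_mul, hg, hε] at this
    exact absurd this (by decide)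

theorem card_reflGroup (hα : ∀ a, α a * α a = 1) {ε : E →* ℤˣ} (hε : ∀ a, ε (α a) = -1)
    (hJ : J.Nonempty) : Nat.card (reflGroup α J) = 2 * Nat.card (evenGroup α J) := by
  obtain ⟨j, hj⟩ := hJ
  have hker : (ε.comp (reflGroup α J).subtype).ker =
      (evenGroup α J).subgroupOf (reflGroup α J) := by
    ext g
    rw [MonoidHom.mem_ker, Subgroup.mem_subgroupOf, mem_evenGroup_iff hα hε]
    simp
  have hidx : (ε.comp (reflGroup α J).subtype).ker.index = 2 := by
    rw [Subgroup.index_ker, MonoidHom.range_eq_top.2, Subgroup.card_top]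
    · simp
    · intro u
      rcases Int.units_eq_one_or u with rfl | rfl
      · exact ⟨1, map_one _⟩
      · exact ⟨⟨α j, mem_reflGroup hj⟩, hε j⟩
  rw [← Subgroup.card_mul_index (ε.comp (reflGroup α J).subtype).ker, hidx, hker, mul_comm,
    Nat.card_congr (Subgroup.subgroupOfEquivOfLe evenGroup_le_reflGroup).toEquiv]

/-- If the `α a`, `a ∈ J`, commute with the `α b`, `b ∈ K`, then every element of the subgroup
generated by all of them is a product of an element of each part. -/
theorem exists_mul_of_mem_reflGroup_union (hα : ∀ a, α a * α a = 1)
    (hcomm : ∀ a ∈ J, ∀ b ∈ K, α a * α b = α b * α a) {g : E} (hg : g ∈ reflGroup α (J ∪ K)) :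
    ∃ u ∈ reflGroup α J, ∃ l ∈ reflGroup α K, g = u * l := by
  refine reflGroup_induction_right
    (p := fun g => ∃ u ∈ reflGroup α J, ∃ l ∈ reflGroup α K, g = u * l) hα
    ⟨1, one_mem _, 1, one_mem _, (mul_one 1).symm⟩ ?_ hg
  rintro _ - a (ha | ha) ⟨u, hu, l, hl, rfl⟩
  · refine ⟨u * α a, mul_mem hu (mem_reflGroup ha), l, hl, ?_⟩
    have hla : l * α a = α a * l := by
      refine reflGroup_induction_right (p := fun l => l * α a = α a * l) hα (by simp) ?_ hl
      intro g _ b hb h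
      rw [mul_assoc, ← hcomm a ha b hb, ← mul_assoc, h, mul_assoc]
    rw [mul_assoc, hla, mul_assoc]
  · exact ⟨u, hu, l * α a, mul_mem hl (mem_reflGroup ha), mul_assoc ..⟩

theorem mem_reflGroup_singleton (hα : ∀ a, α a * α a = 1) {k : κ} {g : E}
    (hg : g ∈ reflGroup α {k}) : g = 1 ∨ g = α k := by
  refine reflGroup_induction_right (p := fun g => g = 1 ∨ g = α k) hα (.inl rfl) ?_ hg
  rintro _ - a rfl (rfl | rfl)
  · simp
  · simp [hα]

end Even

/-! ### The poset of a group with rotation generators -/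

section Poset

variable {E G : Type*} [Group E] [Group G] {m : ℕ}

/-- `G`, with generators `σ`, embeds via `ψ` as the rotation subgroup in the group generated by the
involutions `α`, which satisfy the commutation relations of a string Coxeter group; `ε` is the
sign. -/
structure IsStringGroup (α : Fin (m + 1) → E) (σ : Fin m → G) (ψ : G →* E) (ε : E →* ℤˣ) :
    Prop where
  two_le : 2 ≤ m
  mul_self : ∀ a, α a * α a = 1
  comm : ∀ a b : Fin (m + 1), (a : ℕ) + 2 ≤ b → α a * α b = α b * α a
  sign : ∀ a, ε (α a) = -1
  injective : Function.Injective ψ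
  map_gen : ∀ k, ψ (σ k) = α k.castSucc * α k.succ
  closure_gen : Subgroup.closure (Set.range σ) = ⊤

variable {α : Fin (m + 1) → E} {σ : Fin m → G} {ψ : G →* E} {ε : E →* ℤˣ}

theorem tau_self (σ : Fin m → G) (a : ℕ) : tau σ a a = 1 := by simp [tau]

theorem tau_succ (σ : Fin m → G) {a b : ℕ} (hab : a ≤ b) (hb : b < m) :
    tau σ a (b + 1) = tau σ a b * σ ⟨b, hb⟩ := by
  rw [tau, tau, Nat.sub_add_comm hab, List.prod_take_succ _ _ (by simp; omega)]
  congr 1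
  simp [Nat.add_sub_cancel' hab]

theorem map_tau (hα : ∀ a, α a * α a = 1) (hψ : ∀ k, ψ (σ k) = α k.castSucc * α k.succ)
    {a b : ℕ} (hab : a ≤ b) (hb : b < m + 1) :
    ψ (tau σ a b) = α ⟨a, hab.trans_lt hb⟩ * α ⟨b, hb⟩ := by
  induction b, hab using Nat.le_induction with
  | base => rw [tau_self, map_one, hα]
  | succ b hab ih =>
    rw [tau_succ σ hab (by omega), map_mul, ih (by omega), hψ]
    change _ * α ⟨b, _⟩ * (α ⟨b, _⟩ * α ⟨b + 1, _⟩) = _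
    rw [mul_assoc, ← mul_assoc (α ⟨b, _⟩), hα, one_mul]

theorem map_partGroup (hα : ∀ a, α a * α a = 1) (hψ : ∀ k, ψ (σ k) = α k.castSucc * α k.succ)
    (J : Set (Fin (m + 1))) : (partGroup σ J).map ψ = evenGroup α J := by
  apply le_antisymm
  · rw [partGroup, MonoidHom.map_closure, Subgroup.closure_le]
    rintro _ ⟨_, ⟨a, b, hab, ha, hb, rfl⟩, rfl⟩
    rw [map_tau hα hψ hab.le b.2]
    exact mul_mem_evenGroup ha hb
  · rw [evenGroup, Subgroup.closure_le]
    have hlt : ∀ a ∈ J, ∀ b ∈ J, a < b → α a * α b ∈ (partGroup σ J).map ψ := fun a ha b hb hab =>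
      ⟨tau σ a b, Subgroup.subset_closure ⟨a, b, hab, ha, hb, rfl⟩, map_tau hα hψ hab.le b.2⟩
    rintro _ ⟨a, ha, b, hb, rfl⟩
    rcases lt_trichotomy a b with hab | rfl | hab
    · exact hlt a ha b hb hab
    · rw [hα]; exact one_mem _
    · have := inv_mem (hlt b hb a ha hab)
      rwa [mul_inv_rev, inv_eq_of_mul_eq_one_left (hα a), inv_eq_of_mul_eq_one_left (hα b)] at this

theorem partGroup_univ (σ : Fin m → G) : partGroup σ Set.univ = Subgroup.closure (Set.range σ) := by
  apply le_antisymm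
  · rw [partGroup, Subgroup.closure_le]
    rintro _ ⟨a, b, -, -, -, rfl⟩
    refine list_prod_mem fun x hx => Subgroup.subset_closure ?_
    exact List.mem_ofFn.1 (List.mem_of_mem_drop (List.mem_of_mem_take hx))
  · rw [Subgroup.closure_le]
    rintro _ ⟨k, rfl⟩
    refine Subgroup.subset_closure ⟨k.castSucc, k.succ, Fin.castSucc_lt_succ, trivial, trivial, ?_⟩
    simp [tau_succ σ le_rfl k.2, tau_self]

theorem map_closure_gen (hα : ∀ a, α a * α a = 1)
    (hψ : ∀ k, ψ (σ k) = α k.castSucc * α k.succ) :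
    (Subgroup.closure (Set.range σ)).map ψ = evenGroup α Set.univ := by
  rw [← partGroup_univ, map_partGroup hα hψ]

/-- The rotation subgroup is generated by the products of consecutive involutions. -/
theorem closure_range_mul_succ (hα : ∀ a, α a * α a = 1) :
    Subgroup.closure (Set.range fun k : Fin m => α k.castSucc * α k.succ) =
      evenGroup α Set.univ := by
  have := map_closure_gen (σ := fun k : Fin m => α k.castSucc * α k.succ)
    (ψ := MonoidHom.id E) hα fun _ => rfl
  rwa [Subgroup.map_id] at this

/-- The indices of the involutions that fix the base face of rank `r - 1`. -/
def faceSet (r : Fin (m + 3)) : Set (Fin (m + 1)) := {a | (a : ℕ) + 1 ≠ r}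

theorem faceSet_succ_castSucc (k : Fin (m + 1)) : faceSet k.succ.castSucc = {k}ᶜ := by
  ext a
  simp [faceSet, Fin.ext_iff]

/-- The number of faces of a given rank. -/
theorem card_face (σ : Fin m → G) (r : Fin (m + 3)) :
    Nat.card {x : Face σ // x.rank = (r : ℤ) - 1} = (faceGroup σ r).index := by
  have hidx : ∀ x : Face σ, x.rank = (r : ℤ) - 1 ↔ x.idx = r := fun x => by
    rw [Face.rank, sub_left_inj, Fin.ext_iff]
    exact Nat.cast_inj
  refine Nat.card_congr
    { toFun := fun x => ((hidx x.1).1 x.2) ▸ x.1.coset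
      invFun := fun c => ⟨⟨r, c⟩, (hidx _).2 rfl⟩
      left_inv := ?_
      right_inv := fun c => rfl }
  rintro ⟨⟨r', c⟩, hx⟩
  obtain rfl : r' = r := (hidx _).1 hx
  rfl

end Poset

/-! ### Faces and flags as cosets in the group with reflections -/

namespace IsStringGroup

variable {E G : Type*} [Group E] [Group G] {m : ℕ}
  {α : Fin (m + 1) → E} {σ : Fin m → G} {ψ : G →* E} {ε : E →* ℤˣ}

theorem map_mem_evenGroup_iff (h : IsStringGroup α σ ψ ε) {J : Set (Fin (m + 1))} {g : G} :
    ψ g ∈ evenGroup α J ↔ g ∈ partGroup σ J := by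
  rw [← map_partGroup h.mul_self h.map_gen, Subgroup.mem_map_iff_mem h.injective]

theorem map_mem (h : IsStringGroup α σ ψ ε) (g : G) : ψ g ∈ evenGroup α Set.univ := by
  rw [h.map_mem_evenGroup_iff, partGroup_univ, h.closure_gen]; trivial

theorem exists_of_mem_evenGroup (h : IsStringGroup α σ ψ ε) {γ : E}
    (hγ : γ ∈ evenGroup α Set.univ) :
    ∃ g, ψ g = γ := by
  rw [← map_partGroup h.mul_self h.map_gen] at hγ
  obtain ⟨g, -, hg⟩ := hγ
  exact ⟨g, hg⟩

theorem sign_map (h : IsStringGroup α σ ψ ε) (g : G) : ε (ψ g) = 1 :=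
  sign_of_mem_evenGroup h.sign (h.map_mem g)

/-- Some involution fixes the base faces of two given ranks. -/
theorem exists_mem_faceSet (h : IsStringGroup α σ ψ ε) (r r' : Fin (m + 3)) :
    ∃ s, s ∈ faceSet (m := m) r ∧ s ∈ faceSet (m := m) r' := by
  have hm := h.two_le
  simp only [faceSet, Set.mem_ofPred_eq]
  by_cases h0 : (r : ℕ) ≠ 1 ∧ (r' : ℕ) ≠ 1
  · exact ⟨⟨0, by omega⟩, by simp only; omega, by simp only; omega⟩
  by_cases h1 : (r : ℕ) ≠ 2 ∧ (r' : ℕ) ≠ 2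
  · exact ⟨⟨1, by omega⟩, by simp only; omega, by simp only; omega⟩
  · exact ⟨⟨2, by omega⟩, by simp only; omega, by simp only; omega⟩

/-- An element `γ` of `E` lies on the face `x` if it lies in the coset in `E` that extends the coset
in `G`. -/
def LiesOn (α : Fin (m + 1) → E) (ψ : G →* E) (γ : E) (x : Face σ) : Prop :=
  ∃ g : G, (g : G ⧸ faceGroup σ x.idx) = x.coset ∧ (ψ g)⁻¹ * γ ∈ reflGroup α (faceSet x.idx)

theorem liesOn_unique (h : IsStringGroup α σ ψ ε) {γ : E} {x y : Face σ} (hxy : x.idx = y.idx)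
    (hx : LiesOn α ψ γ x) (hy : LiesOn α ψ γ y) : x = y := by
  obtain ⟨r, c⟩ := x
  obtain ⟨r', c'⟩ := y
  obtain rfl : r = r' := hxy
  obtain ⟨g, hgc, hg⟩ := hx
  obtain ⟨g', hgc', hg'⟩ := hy
  change (g : G ⧸ faceGroup σ r) = c at hgc
  change (g' : G ⧸ faceGroup σ r) = c' at hgc'
  subst hgc hgc'
  congr 1
  refine (QuotientGroup.eq (s := faceGroup σ r)).2 ?_
  change g⁻¹ * g' ∈ partGroup σ (faceSet r)
  rw [← h.map_mem_evenGroup_iff, mem_evenGroup_iff h.mul_self h.sign]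
  refine ⟨?_, h.sign_map _⟩
  have := mul_mem hg (inv_mem hg')
  simpa [mul_assoc] using this

theorem LiesOn.mul (γ : E) {δ : E} {x : Face σ} (hx : LiesOn α ψ γ x)
    (hδ : δ ∈ reflGroup α (faceSet x.idx)) : LiesOn α ψ (γ * δ) x := by
  obtain ⟨g, hg, hγ⟩ := hx
  exact ⟨g, hg, by rw [← mul_assoc]; exact mul_mem hγ hδ⟩

theorem LiesOn.inv_mul_mem (h : IsStringGroup α σ ψ ε) {γ δ : E} {x : Face σ}
    (hγ : LiesOn α ψ γ x) (hδ : LiesOn α ψ δ x) : γ⁻¹ * δ ∈ reflGroup α (faceSet x.idx) := by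
  obtain ⟨g, hg, hγ⟩ := hγ
  obtain ⟨g', hg', hδ⟩ := hδ
  have h1 := (QuotientGroup.eq (s := faceGroup σ x.idx)).1 (hg.trans hg'.symm)
  have h2 := evenGroup_le_reflGroup (h.map_mem_evenGroup_iff.2 h1)
  have := mul_mem (mul_mem (inv_mem hγ) h2) hδ
  simpa [mul_assoc] using this

theorem exists_liesOn (h : IsStringGroup α σ ψ ε) {γ : E} (hγ : γ ∈ reflGroup α Set.univ)
    (r : Fin (m + 3)) : ∃ x : Face σ, x.idx = r ∧ LiesOn α ψ γ x := by
  obtain ⟨s, hs, -⟩ := h.exists_mem_faceSet r r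
  rcases mem_evenGroup_or h.mul_self (Set.mem_univ s) hγ with hγ | hγ
  · obtain ⟨g, rfl⟩ := h.exists_of_mem_evenGroup hγ
    exact ⟨⟨r, g⟩, rfl, g, rfl, by simp⟩
  · obtain ⟨g, hg⟩ := h.exists_of_mem_evenGroup hγ
    refine ⟨⟨r, g⟩, rfl, g, rfl, ?_⟩
    rw [hg]
    simpa using mem_reflGroup hs

/-- The group generated by the involutions; its elements correspond to the flags. -/
abbrev Refl (_ : IsStringGroup α σ ψ ε) : Type _ := reflGroup α Set.univ

/-- The involutions as elements of the group they generate. -/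
def gen (h : IsStringGroup α σ ψ ε) (a : Fin (m + 1)) : h.Refl :=
  ⟨α a, mem_reflGroup (Set.mem_univ a)⟩

/-- The face of rank `r - 1` of the flag that corresponds to `γ`. -/
noncomputable def faceOf (h : IsStringGroup α σ ψ ε) (γ : h.Refl) (r : Fin (m + 3)) : Face σ :=
  Classical.choose (h.exists_liesOn γ.2 r)

variable (h : IsStringGroup α σ ψ ε)

theorem idx_faceOf (γ : h.Refl) (r : Fin (m + 3)) : (h.faceOf γ r).idx = r :=
  (Classical.choose_spec (h.exists_liesOn γ.2 r)).1

theorem liesOn_faceOf (γ : h.Refl) (r : Fin (m + 3)) : LiesOn α ψ (γ : E) (h.faceOf γ r) :=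
  (Classical.choose_spec (h.exists_liesOn γ.2 r)).2

theorem eq_faceOf_iff {γ : h.Refl} {x : Face σ} {r : Fin (m + 3)} (hx : x.idx = r) :
    x = h.faceOf γ r ↔ LiesOn α ψ (γ : E) x := by
  refine ⟨fun e => e ▸ h.liesOn_faceOf γ r, fun hγ => ?_⟩
  exact h.liesOn_unique (hx.trans (h.idx_faceOf γ r).symm) hγ (h.liesOn_faceOf γ r)

theorem faceOf_eq_iff {γ δ : h.Refl} {r : Fin (m + 3)} :
    h.faceOf γ r = h.faceOf δ r ↔ (γ : E)⁻¹ * δ ∈ reflGroup α (faceSet r) := by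
  rw [h.eq_faceOf_iff (h.idx_faceOf γ r)]
  constructor
  · intro hδ
    simpa only [h.idx_faceOf] using (h.liesOn_faceOf γ r).inv_mul_mem h hδ
  · intro hγδ
    have := (h.liesOn_faceOf γ r).mul _ (δ := (γ : E)⁻¹ * δ) (by rwa [h.idx_faceOf])
    rwa [mul_inv_cancel_left] at this

theorem faceOf_mul {γ δ : h.Refl} {r : Fin (m + 3)} (hδ : (δ : E) ∈ reflGroup α (faceSet r)) :
    h.faceOf (γ * δ) r = h.faceOf γ r := by
  rw [eq_comm, h.faceOf_eq_iff]
  simpa using hδ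

theorem le_iff (h : IsStringGroup α σ ψ ε) {x y : Face σ} : x ≤ y ↔ x.idx ≤ y.idx ∧
    ∃ γ : h.Refl, x = h.faceOf γ x.idx ∧ y = h.faceOf γ y.idx := by
  have hmk : ∀ g : G, ∃ γ : h.Refl, (γ : E) = ψ g := fun g =>
    ⟨⟨ψ g, evenGroup_le_reflGroup (h.map_mem g)⟩, rfl⟩
  constructor
  · rintro ⟨hle, g, hx, hy⟩
    obtain ⟨γ, hγ⟩ := hmk g
    refine ⟨hle, γ, ?_, ?_⟩ <;> rw [h.eq_faceOf_iff rfl, hγ]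
    · exact ⟨g, hx, by simp⟩
    · exact ⟨g, hy, by simp⟩
  · rintro ⟨hle, γ, hx, hy⟩
    rw [h.eq_faceOf_iff rfl] at hx hy
    obtain ⟨s, hsx, hsy⟩ := h.exists_mem_faceSet x.idx y.idx
    have key : ∀ g : G, ∀ z : Face σ, LiesOn α ψ (ψ g) z →
        (g : G ⧸ faceGroup σ z.idx) = z.coset := by
      intro g z hz
      have h1 : (⟨z.idx, g⟩ : Face σ) = z := h.liesOn_unique rfl ⟨g, rfl, by simp⟩ hz
      have h2 := (Face.ext_iff.1 h1).2
      exact eq_of_heq h2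
    refine ⟨hle, ?_⟩
    rcases mem_evenGroup_or h.mul_self (Set.mem_univ s) γ.2 with hγ | hγ
    · obtain ⟨g, hg⟩ := h.exists_of_mem_evenGroup hγ
      exact ⟨g, key g x (hg ▸ hx), key g y (hg ▸ hy)⟩
    · obtain ⟨g, hg⟩ := h.exists_of_mem_evenGroup hγ
      exact ⟨g, key g x (hg ▸ hx.mul _ (mem_reflGroup hsx)),
        key g y (hg ▸ hy.mul _ (mem_reflGroup hsy))⟩

theorem faceOf_le_faceOf (γ : h.Refl) {r s : Fin (m + 3)} (hrs : r ≤ s) :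
    h.faceOf γ r ≤ h.faceOf γ s := by
  rw [h.le_iff]
  simp only [h.idx_faceOf]
  exact ⟨hrs, γ, rfl, rfl⟩

theorem faceOf_injective (γ : h.Refl) : Function.Injective (h.faceOf γ) := fun r s hrs => by
  rw [← h.idx_faceOf γ r, hrs, h.idx_faceOf]

/-- An element that fixes a base face is a product of one that fixes all base faces of higher rank
and one that fixes all base faces of lower rank. -/
theorem exists_mul_of_mem_faceSet (h : IsStringGroup α σ ψ ε) {s : Fin (m + 3)} {g : E}
    (hg : g ∈ reflGroup α (faceSet s)) :
    ∃ u ∈ reflGroup α {a | (s : ℕ) < a + 1}, ∃ l ∈ reflGroup α {a | (a : ℕ) + 1 < s},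
      g = u * l := by
  refine exists_mul_of_mem_reflGroup_union h.mul_self ?_ (reflGroup_mono ?_ hg)
  · intro a ha b hb
    simp only [Set.mem_ofPred_eq] at ha hb
    exact (h.comm b a (by omega)).symm
  · intro a ha
    simp only [faceSet, Set.mem_ofPred_eq, Set.mem_union] at ha ⊢
    omega

/-- Every chain is part of the chain of faces of some group element. -/
theorem exists_faceOf_of_isChain (h : IsStringGroup α σ ψ ε) {c : Set (Face σ)}
    (hc : IsChain (· ≤ ·) c) :
    ∃ γ : h.Refl, ∀ x ∈ c, x = h.faceOf γ x.idx := by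
  suffices ∀ n : ℕ, ∃ γ : h.Refl, ∀ x ∈ c, (x.idx : ℕ) < n → x = h.faceOf γ x.idx by
    obtain ⟨γ, hγ⟩ := this (m + 3)
    exact ⟨γ, fun x hx => hγ x hx x.idx.2⟩
  intro n
  induction n with
  | zero => exact ⟨1, fun x _ hx => absurd hx (by omega)⟩
  | succ n ih =>
    obtain ⟨γ, hγ⟩ := ih
    by_cases hy : ∃ y ∈ c, (y.idx : ℕ) = n
    swap
    · exact ⟨γ, fun x hx hxn => hγ x hx (lt_of_le_of_ne (by omega) fun e => hy ⟨x, hx, e⟩)⟩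
    obtain ⟨y, hyc, hyn⟩ := hy
    have hyy : ∃ η : h.Refl, y = h.faceOf η y.idx := by
      obtain ⟨-, η, hη, -⟩ := h.le_iff.1 (show y ≤ y from ⟨le_rfl, by
        obtain ⟨g, hg⟩ := QuotientGroup.mk_surjective y.coset
        exact ⟨g, hg, hg⟩⟩)
      exact ⟨η, hη⟩
    have hsame : ∀ x ∈ c, ∀ z ∈ c, x.idx = z.idx → x = z := by
      intro x hx z hz hxz
      by_contra hne
      rcases hc hx hz hne with hle | hle
      · obtain ⟨-, η, h1, h2⟩ := h.le_iff.1 hle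
        exact hne (by rw [h1, h2, hxz])
      · obtain ⟨-, η, h1, h2⟩ := h.le_iff.1 hle
        exact hne (by rw [h1, h2, hxz])
    by_cases hlow : ∃ x ∈ c, (x.idx : ℕ) < n
    swap
    · obtain ⟨η, hη⟩ := hyy
      refine ⟨η, fun x hx hxn => ?_⟩
      obtain rfl : x = y := hsame x hx y hyc (Fin.ext (by
        have : ¬ (x.idx : ℕ) < n := fun hlt => hlow ⟨x, hx, hlt⟩
        omega))
      exact hη
    -- the highest face of the chain below rank `n`
    obtain ⟨x, ⟨hxc, hxn⟩, hmax⟩ : ∃ x, (x ∈ c ∧ (x.idx : ℕ) < n) ∧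
        ∀ z ∈ c, (z.idx : ℕ) < n → (z.idx : ℕ) ≤ x.idx := by
      obtain ⟨x, hx, hmax⟩ := WellFounded.has_min
        (measure fun x : Face σ => m + 3 - (x.idx : ℕ)).wf {x | x ∈ c ∧ (x.idx : ℕ) < n} hlow
      refine ⟨x, hx, fun z hz hzn => ?_⟩
      have : ¬ (m + 3 - (z.idx : ℕ) < m + 3 - (x.idx : ℕ)) := hmax z ⟨hz, hzn⟩
      omega
    have hxy : x ≤ y := by
      rcases hc hxc hyc (fun e => by rw [e] at hxn; omega) with hle | hle
      · exact hle
      · have := Fin.le_def.1 hle.1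
        omega
    obtain ⟨-, η, hηx, hηy⟩ := h.le_iff.1 hxy
    have hmem := h.faceOf_eq_iff.1 ((hγ x hxc hxn).symm.trans hηx)
    obtain ⟨u, hu, l, hl, hul⟩ := h.exists_mul_of_mem_faceSet hmem
    have huΓ : u ∈ reflGroup α Set.univ := reflGroup_mono (Set.subset_univ _) hu
    have hlΓ : l ∈ reflGroup α Set.univ := reflGroup_mono (Set.subset_univ _) hl
    have hξ : γ * ⟨u, huΓ⟩ = η * ⟨l, hlΓ⟩⁻¹ := by
      apply Subtype.ext
      change (γ : E) * u = η * l⁻¹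
      rw [eq_mul_inv_iff_mul_eq, mul_assoc, ← hul, mul_inv_cancel_left]
    refine ⟨γ * ⟨u, huΓ⟩, fun z hz hzn => ?_⟩
    rcases (Nat.lt_succ_iff.1 hzn).lt_or_eq with hlt | heq
    · rw [h.faceOf_mul]
      · exact hγ z hz hlt
      · have := hmax z hz hlt
        refine reflGroup_mono (fun a ha => ?_) hu
        simp only [faceSet, Set.mem_ofPred_eq] at ha ⊢
        omega
    · obtain rfl : z = y := hsame z hz y hyc (Fin.ext (heq.trans hyn.symm))
      rw [hξ, h.faceOf_mul]
      · exact hηy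
      · refine inv_mem (reflGroup_mono (fun a ha => ?_) hl)
        simp only [faceSet, Set.mem_ofPred_eq] at ha ⊢
        omega

/-- The flag that corresponds to a group element. -/
noncomputable def flagOf (γ : h.Refl) : Flag (Face σ) where
  carrier := Set.range (h.faceOf γ)
  Chain' := by
    rintro _ ⟨r, rfl⟩ _ ⟨s, rfl⟩ -
    exact (le_total r s).imp (h.faceOf_le_faceOf γ) (h.faceOf_le_faceOf γ)
  max_chain' := by
    intro c hc hsub
    obtain ⟨δ, hδ⟩ := h.exists_faceOf_of_isChain hc
    refine hsub.antisymm fun x hx => ⟨x.idx, ?_⟩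
    have := hδ _ (hsub ⟨x.idx, rfl⟩)
    rw [this, h.idx_faceOf, ← hδ x hx]

theorem coe_flagOf (γ : h.Refl) : (h.flagOf γ : Set (Face σ)) = Set.range (h.faceOf γ) := rfl

theorem exists_flagOf (h : IsStringGroup α σ ψ ε) (Φ : Flag (Face σ)) : ∃ γ, Φ = h.flagOf γ := by
  obtain ⟨γ, hγ⟩ := h.exists_faceOf_of_isChain Φ.Chain'
  refine ⟨γ, Flag.ext ?_⟩
  exact Φ.max_chain' (h.flagOf γ).Chain' fun x hx => ⟨x.idx, (hγ x hx).symm⟩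

theorem ncard_flag (h : IsStringGroup α σ ψ ε) (Φ : Flag (Face σ)) :
    (Φ : Set (Face σ)).ncard = m + 3 := by
  obtain ⟨γ, rfl⟩ := h.exists_flagOf Φ
  rw [coe_flagOf, ← Set.image_univ, Set.ncard_image_of_injective _ (h.faceOf_injective γ),
    Set.ncard_univ, Nat.card_fin]

theorem faceOf_mem_flagOf {γ δ : h.Refl} {r : Fin (m + 3)} :
    h.faceOf γ r ∈ (h.flagOf δ : Set (Face σ)) ↔ (γ : E)⁻¹ * δ ∈ reflGroup α (faceSet r) := by
  rw [← h.faceOf_eq_iff]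
  constructor
  · rintro ⟨s, hs⟩
    obtain rfl : s = r := by rw [← h.idx_faceOf δ s, hs, h.idx_faceOf]
    exact hs.symm
  · exact fun e => ⟨r, e.symm⟩

theorem flagOf_diff (γ δ : h.Refl) : (h.flagOf γ : Set (Face σ)) \ h.flagOf δ =
    h.faceOf γ '' {r | (γ : E)⁻¹ * δ ∉ reflGroup α (faceSet r)} := by
  ext x
  constructor
  · rintro ⟨⟨r, rfl⟩, hx⟩
    exact ⟨r, fun hr => hx (h.faceOf_mem_flagOf.2 hr), rfl⟩
  · rintro ⟨r, hr, rfl⟩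
    exact ⟨⟨r, rfl⟩, fun hx => hr (h.faceOf_mem_flagOf.1 hx)⟩

theorem flagAdjacent_flagOf {γ δ : h.Refl} : FlagAdjacent (h.flagOf γ) (h.flagOf δ) ↔
    {r | (γ : E)⁻¹ * δ ∉ reflGroup α (faceSet r)}.ncard = 1 := by
  have hsymm : {r | (δ : E)⁻¹ * γ ∉ reflGroup α (faceSet r)} =
      {r | (γ : E)⁻¹ * δ ∉ reflGroup α (faceSet r)} := by
    ext r
    simp only [Set.mem_ofPred_eq]
    rw [← inv_mem_iff, mul_inv_rev, inv_inv]
  rw [FlagAdjacent, flagOf_diff, flagOf_diff, hsymm,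
    Set.ncard_image_of_injective _ (h.faceOf_injective γ),
    Set.ncard_image_of_injective _ (h.faceOf_injective δ), and_self]

end IsStringGroup

/-! ### Pre-polytopes and polytopes -/

/-- The instances of the intersection property that make the poset a pre-polytope: only the identity
fixes all base faces, an element that fixes the base faces of ranks `k - 1` and `k + 1` is generated
by the involutions that do, and no involution fixes the base face of its own rank. -/
structure IsThin {E : Type*} [Group E] {m : ℕ} (α : Fin (m + 1) → E) : Prop where
  eq_one : ∀ g ∈ reflGroup α Set.univ, (∀ k, g ∈ reflGroup α {k}ᶜ) → g = 1
  mem_of_adjacent : ∀ k : Fin (m + 1), ∀ g ∈ reflGroup α Set.univ,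
    (∀ a : Fin (m + 1), (a : ℕ) + 1 = k ∨ (k : ℕ) + 1 = a → g ∈ reflGroup α {a}ᶜ) →
      g ∈ reflGroup α {a | ¬ ((a : ℕ) + 1 = k ∨ (k : ℕ) + 1 = a)}
  notMem : ∀ k, α k ∉ reflGroup α {k}ᶜ

namespace IsStringGroup

variable {E G : Type*} [Group E] [Group G] {m : ℕ}
  {α : Fin (m + 1) → E} {σ : Fin m → G} {ψ : G →* E} {ε : E →* ℤˣ}

theorem inv_mul_mem_univ (h : IsStringGroup α σ ψ ε) (γ δ : h.Refl) :
    (γ : E)⁻¹ * δ ∈ reflGroup α Set.univ := (γ⁻¹ * δ).2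

theorem mem_faceSet_iff_forall {g : E} (hg : g ∈ reflGroup α Set.univ) {r : Fin (m + 3)} :
    g ∈ reflGroup α (faceSet r) ↔ ∀ k : Fin (m + 1), (k : ℕ) + 1 = r → g ∈ reflGroup α {k}ᶜ := by
  constructor
  · rintro h k hk
    refine reflGroup_mono (fun a ha => ?_) h
    rintro rfl
    exact ha hk
  · intro h
    by_cases hr : ∃ k : Fin (m + 1), (k : ℕ) + 1 = r
    · obtain ⟨k, hk⟩ := hr
      have hsub : ({k}ᶜ : Set (Fin (m + 1))) ⊆ faceSet r := by
        intro a ha hak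
        rw [Set.mem_compl_iff, Set.mem_singleton_iff, Fin.ext_iff] at ha
        omega
      exact reflGroup_mono hsub (h k hk)
    · exact reflGroup_mono (fun a _ hak => hr ⟨a, hak⟩) hg

/-- The elements that fix the base faces of ranks `k - 1` and `k + 1` permute the base face of rank
`k` like a power of `α k`. -/
theorem exists_mul_of_adjacent (h : IsStringGroup α σ ψ ε) (ht : IsThin α) {k : Fin (m + 1)} {g : E}
    (hg : g ∈ reflGroup α Set.univ)
    (hk : ∀ a : Fin (m + 1), (a : ℕ) + 1 = k ∨ (k : ℕ) + 1 = a → g ∈ reflGroup α {a}ᶜ) :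
    ∃ u, (u = 1 ∨ u = α k) ∧ ∃ l ∈ reflGroup α {k}ᶜ, g = u * l := by
  have hcomm : ∀ a ∈ ({k} : Set (Fin (m + 1))),
      ∀ b ∈ {a : Fin (m + 1) | a ≠ k ∧ ¬ ((a : ℕ) + 1 = k ∨ (k : ℕ) + 1 = a)},
      α a * α b = α b * α a := by
    rintro a rfl b ⟨hb, hb'⟩
    have hne : (b : ℕ) ≠ a := fun e => hb (Fin.ext e)
    rcases lt_or_gt_of_ne hne with hlt | hlt
    · exact (h.comm b a (by omega)).symm
    · exact h.comm a b (by omega)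
  have hsub : {a : Fin (m + 1) | ¬ ((a : ℕ) + 1 = k ∨ (k : ℕ) + 1 = a)} ⊆
      {k} ∪ {a | a ≠ k ∧ ¬ ((a : ℕ) + 1 = k ∨ (k : ℕ) + 1 = a)} := by
    intro a ha
    by_cases hak : a = k
    · exact .inl hak
    · exact .inr ⟨hak, ha⟩
  obtain ⟨u, hu, l, hl, rfl⟩ := exists_mul_of_mem_reflGroup_union h.mul_self hcomm
    (reflGroup_mono hsub (ht.mem_of_adjacent k g hg hk))
  exact ⟨u, mem_reflGroup_singleton h.mul_self hu, l, reflGroup_mono (fun a ha => ha.1) hl, rfl⟩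

theorem flagAdjacent_iff (h : IsStringGroup α σ ψ ε) (ht : IsThin α) {γ δ : h.Refl} :
    FlagAdjacent (h.flagOf γ) (h.flagOf δ) ↔ ∃ k, δ = γ * h.gen k := by
  rw [flagAdjacent_flagOf]
  have hmem : ∀ {γ δ : h.Refl} {r}, r ∈ {r | (γ : E)⁻¹ * δ ∉ reflGroup α (faceSet r)} ↔
      ∃ k : Fin (m + 1), (k : ℕ) + 1 = r ∧ (γ : E)⁻¹ * δ ∉ reflGroup α {k}ᶜ := by
    intro γ δ r
    rw [Set.mem_ofPred_eq, mem_faceSet_iff_forall (h.inv_mul_mem_univ γ δ)]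
    push Not
    rfl
  constructor
  · intro h1
    obtain ⟨r, hr⟩ := Set.ncard_eq_one.1 h1
    obtain ⟨k, hk, hnot⟩ := hmem.1 (hr.symm ▸ Set.mem_singleton r)
    have hother : ∀ a, a ≠ k → (γ : E)⁻¹ * δ ∈ reflGroup α {a}ᶜ := by
      intro a hak
      by_contra hcon
      have : a.succ.castSucc ∈ ({r} : Set _) := hr ▸ hmem.2 ⟨a, by simp, hcon⟩
      rw [Set.mem_singleton_iff, Fin.ext_iff] at this
      simp only [Fin.val_castSucc, Fin.val_succ] at this
      exact hak (Fin.ext (by omega))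
    obtain ⟨u, hu, l, hl, hul⟩ := h.exists_mul_of_adjacent ht (k := k) (γ⁻¹ * δ).2
      fun a ha => hother a (by rintro rfl; omega)
    change (γ : E)⁻¹ * δ = u * l at hul
    have hlu : l = u⁻¹ * ((γ : E)⁻¹ * δ) := by rw [hul, inv_mul_cancel_left]
    have huΓ : ∀ K : Set (Fin (m + 1)), k ∈ K → u ∈ reflGroup α K := by
      intro K hK
      rcases hu with rfl | rfl
      · exact one_mem _
      · exact mem_reflGroup hK
    have hl1 : l = 1 := by
      refine ht.eq_one l (reflGroup_mono (Set.subset_univ _) hl) fun a => ?_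
      by_cases hak : a = k
      · exact hak ▸ hl
      · rw [hlu]
        exact mul_mem (inv_mem (huΓ _ (Ne.symm hak))) (hother a hak)
    rw [hl1, mul_one] at hul
    rcases hu with rfl | rfl
    · exact absurd (hul ▸ one_mem _) hnot
    · refine ⟨k, Subtype.ext ?_⟩
      change (δ : E) = γ * α k
      rw [← hul, mul_inv_cancel_left]
  · rintro ⟨k, rfl⟩
    rw [Set.ncard_eq_one]
    refine ⟨k.succ.castSucc, Set.ext fun r => hmem.trans ?_⟩
    have hγ : (γ : E)⁻¹ * (γ * h.gen k : h.Refl) = α k := inv_mul_cancel_left _ _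
    rw [hγ, Set.mem_singleton_iff, Fin.ext_iff]
    simp only [Fin.val_castSucc, Fin.val_succ]
    constructor
    · rintro ⟨a, ha, hnot⟩
      by_cases hak : a = k
      · rw [← ha, hak]
      · exact absurd (mem_reflGroup (Ne.symm hak)) hnot
    · exact fun hr => ⟨k, hr.symm, ht.notMem k⟩

theorem flagOf_injective (h : IsStringGroup α σ ψ ε) (ht : IsThin α) :
    Function.Injective h.flagOf := by
  intro γ δ e
  have : (γ : E)⁻¹ * δ = 1 := by
    refine ht.eq_one _ (γ⁻¹ * δ).2 fun k => ?_
    have : h.faceOf γ k.succ.castSucc ∈ (h.flagOf δ : Set (Face σ)) := e ▸ ⟨_, rfl⟩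
    rwa [faceOf_mem_flagOf, faceSet_succ_castSucc] at this
  exact Subtype.ext (inv_mul_eq_one.1 this)

theorem card_flag (h : IsStringGroup α σ ψ ε) (ht : IsThin α) :
    Nat.card (Flag (Face σ)) = 2 * Nat.card G := by
  rw [← Nat.card_congr (Equiv.ofBijective h.flagOf
    ⟨h.flagOf_injective ht, fun Φ => (h.exists_flagOf Φ).imp fun _ => Eq.symm⟩),
    card_reflGroup h.mul_self h.sign ⟨0, Set.mem_univ _⟩,
    ← map_closure_gen h.mul_self h.map_gen, h.closure_gen,
    Nat.card_congr ((⊤ : Subgroup G).equivMapOfInjective ψ h.injective).toEquiv.symm,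
    Subgroup.card_top]

/-- The diamond condition at the flag of `γ`: the two faces of rank `k` are those of `γ` and of the
adjacent flag. -/
theorem between_eq (h : IsStringGroup α σ ψ ε) (ht : IsThin α) (γ : h.Refl) (k : Fin (m + 1)) :
    {z : Face σ | z.idx = k.succ.castSucc ∧ h.faceOf γ k.castSucc.castSucc ≤ z ∧
      z ≤ h.faceOf γ k.succ.succ} =
    {h.faceOf γ k.succ.castSucc, h.faceOf (γ * h.gen k) k.succ.castSucc} := by
  have hgen : ∀ r : Fin (m + 3), (k : ℕ) + 1 ≠ r →
      h.faceOf (γ * h.gen k) r = h.faceOf γ r := fun r hr =>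
    h.faceOf_mul (mem_reflGroup hr)
  have hlow := hgen k.castSucc.castSucc (by simp)
  have hhigh := hgen k.succ.succ (by simp)
  have hle1 : (k.castSucc.castSucc : Fin (m + 3)) ≤ k.succ.castSucc := by simp [Fin.le_def]
  have hle2 : (k.succ.castSucc : Fin (m + 3)) ≤ k.succ.succ := by simp [Fin.le_def]
  ext z
  simp only [Set.mem_ofPred_eq, Set.mem_insert_iff, Set.mem_singleton_iff]
  constructor
  · rintro ⟨hz, hxz, hzy⟩
    have hchain : IsChain (· ≤ ·)
        ({h.faceOf γ k.castSucc.castSucc, z, h.faceOf γ k.succ.succ} : Set (Face σ)) := by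
      have hxy := h.faceOf_le_faceOf γ (hle1.trans hle2)
      rintro a (rfl | rfl | rfl) b (rfl | rfl | rfl) hab <;>
        first | exact absurd rfl hab | exact .inl ‹_› | exact .inr ‹_›
    obtain ⟨δ, hδ⟩ := h.exists_faceOf_of_isChain hchain
    have h1 := hδ _ (.inl rfl)
    have h2 := hδ _ (.inr (.inl rfl))
    have h3 := hδ _ (.inr (.inr rfl))
    rw [h.idx_faceOf] at h1 h3
    rw [hz] at h2
    rw [h.faceOf_eq_iff] at h1 h3
    obtain ⟨u, hu, l, hl, hul⟩ := h.exists_mul_of_adjacent ht (k := k) (γ⁻¹ * δ).2 (by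
      rintro a (ha | ha)
      · exact (mem_faceSet_iff_forall (h.inv_mul_mem_univ γ δ)).1 h1 a (by simpa using ha)
      · exact (mem_faceSet_iff_forall (h.inv_mul_mem_univ γ δ)).1 h3 a (by simp; omega))
    change (γ : E)⁻¹ * δ = u * l at hul
    rw [h2]
    rcases hu with rfl | rfl
    · left
      rw [eq_comm, h.faceOf_eq_iff, faceSet_succ_castSucc, hul, one_mul]
      exact hl
    · right
      rw [eq_comm, h.faceOf_eq_iff, faceSet_succ_castSucc]
      change ((γ : E) * α k)⁻¹ * δ ∈ _
      rwa [mul_inv_rev, mul_assoc, hul, inv_mul_cancel_left]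
  · rintro (rfl | rfl)
    · exact ⟨h.idx_faceOf _ _, h.faceOf_le_faceOf γ hle1, h.faceOf_le_faceOf γ hle2⟩
    · refine ⟨h.idx_faceOf _ _, ?_, ?_⟩
      · rw [← hlow]; exact h.faceOf_le_faceOf _ hle1
      · rw [← hhigh]; exact h.faceOf_le_faceOf _ hle2

theorem le_refl_face (_ : IsStringGroup α σ ψ ε) (x : Face σ) : x ≤ x := by
  obtain ⟨g, hg⟩ := QuotientGroup.mk_surjective x.coset
  exact ⟨le_rfl, g, hg, hg⟩

theorem isPrePolytope (h : IsStringGroup α σ ψ ε) (ht : IsThin α) :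
    IsPrePolytope (Face σ) Face.rank (m + 1) where
  le_refl := h.le_refl_face
  le_trans x y z hxy hyz := by
    by_cases hxy' : x = y
    · rwa [hxy']
    obtain ⟨hi, γ, hx, hy⟩ := h.le_iff.1 hxy
    obtain ⟨hi', δ, hy', hz⟩ := h.le_iff.1 hyz
    have hmem := h.faceOf_eq_iff.1 (hy.symm.trans hy')
    obtain ⟨u, hu, l, hl, hul⟩ := h.exists_mul_of_mem_faceSet hmem
    have huΓ : u ∈ reflGroup α Set.univ := reflGroup_mono (Set.subset_univ _) hu
    have hlΓ : l ∈ reflGroup α Set.univ := reflGroup_mono (Set.subset_univ _) hl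
    have hξ : γ * ⟨u, huΓ⟩ = δ * ⟨l, hlΓ⟩⁻¹ := by
      apply Subtype.ext
      change (γ : E) * u = δ * l⁻¹
      rw [eq_mul_inv_iff_mul_eq, mul_assoc, ← hul, mul_inv_cancel_left]
    rw [h.le_iff]
    refine ⟨hi.trans hi', γ * ⟨u, huΓ⟩, ?_, ?_⟩
    · rw [h.faceOf_mul, ← hx]
      refine reflGroup_mono (fun a ha => ?_) hu
      have := Fin.le_def.1 hi
      simp only [faceSet, Set.mem_ofPred_eq] at ha ⊢
      omega
    · rw [hξ, h.faceOf_mul, ← hz]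
      refine inv_mem (reflGroup_mono (fun a ha => ?_) hl)
      have := Fin.le_def.1 hi'
      simp only [faceSet, Set.mem_ofPred_eq] at ha ⊢
      omega
  le_antisymm x y hxy hyx := by
    obtain ⟨hi, γ, hx, hy⟩ := h.le_iff.1 hxy
    rw [hx, hy, le_antisymm hi hyx.1]
  rank_lt x y hxy hne := by
    obtain ⟨hi, γ, hx, hy⟩ := h.le_iff.1 hxy
    have hlt := lt_of_le_of_ne hi fun e => hne (by rw [hx, hy, e])
    simp only [Face.rank]
    have := Fin.lt_def.1 hlt
    omega
  rank_mem x := by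
    simp only [Face.rank]
    have := x.idx.2
    push_cast
    omega
  exists_least := by
    refine ⟨h.faceOf 1 0, by simp [Face.rank, h.idx_faceOf], fun y => ?_⟩
    obtain ⟨-, γ, hγ, -⟩ := h.le_iff.1 (h.le_refl_face y)
    have : h.faceOf 1 0 = h.faceOf γ 0 := by
      rw [h.faceOf_eq_iff, mem_faceSet_iff_forall (h.inv_mul_mem_univ 1 γ)]
      intro k hk
      simp at hk
    rw [this, hγ]
    exact h.faceOf_le_faceOf γ (Fin.zero_le _)
  exists_greatest := by
    refine ⟨h.faceOf 1 (Fin.last _), by simp [Face.rank, h.idx_faceOf]; ring, fun y => ?_⟩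
    obtain ⟨-, γ, hγ, -⟩ := h.le_iff.1 (h.le_refl_face y)
    have : h.faceOf 1 (Fin.last _) = h.faceOf γ (Fin.last _) := by
      rw [h.faceOf_eq_iff, mem_faceSet_iff_forall (h.inv_mul_mem_univ 1 γ)]
      intro k hk
      simp only [Fin.val_last] at hk
      omega
    rw [this, hγ]
    exact h.faceOf_le_faceOf γ (Fin.le_last _)
  card_flag Φ := h.ncard_flag Φ
  diamond j x y hxy hx hy := by
    obtain ⟨-, γ, hγx, hγy⟩ := h.le_iff.1 hxy
    simp only [Face.rank] at hx hy
    have hyl := y.idx.2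
    obtain ⟨k, hk⟩ : ∃ k : Fin (m + 1), ((k : ℕ) : ℤ) = j := ⟨⟨(x.idx : ℕ), by omega⟩, by
      simp only; omega⟩
    have hxk : x.idx = k.castSucc.castSucc := Fin.ext (by simp; omega)
    have hyk : y.idx = k.succ.succ := Fin.ext (by simp; omega)
    rw [hxk] at hγx
    rw [hyk] at hγy
    have hset : {z : Face σ | z.rank = j ∧ x ≤ z ∧ z ≤ y} =
        {h.faceOf γ k.succ.castSucc, h.faceOf (γ * h.gen k) k.succ.castSucc} := by
      rw [← h.between_eq ht, ← hγx, ← hγy]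
      ext z
      have : z.rank = j ↔ z.idx = k.succ.castSucc := by
        rw [Face.rank, ← hk, Fin.ext_iff]
        simp only [Fin.val_castSucc, Fin.val_succ]
        omega
      simp only [Set.mem_ofPred_eq, this]
    rw [hset, Set.ncard_pair]
    rw [Ne, h.faceOf_eq_iff, faceSet_succ_castSucc]
    have hγ : (γ : E)⁻¹ * (γ * h.gen k : h.Refl) = α k := inv_mul_cancel_left _ _
    rw [hγ]
    exact ht.notMem k

/-- Two flags that differ by an element generated by the involutions in `J` are joined by flags that
keep all faces fixed by those involutions. -/
theorem reflTransGen_flagOf (h : IsStringGroup α σ ψ ε) (ht : IsThin α) {J : Set (Fin (m + 1))}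
    (γ : h.Refl) {S : Set (Face σ)}
    (hS : ∀ δ : h.Refl, (δ : E) ∈ reflGroup α J → S ⊆ h.flagOf (γ * δ)) {δ : E}
    (hδ : δ ∈ reflGroup α J) (hδΓ : δ ∈ reflGroup α Set.univ) :
    Relation.ReflTransGen (fun A B : Flag (Face σ) => FlagAdjacent A B ∧ S ⊆ A ∧ S ⊆ B)
      (h.flagOf γ) (h.flagOf (γ * ⟨δ, hδΓ⟩)) := by
  suffices ∃ hδΓ : δ ∈ reflGroup α Set.univ,
      Relation.ReflTransGen (fun A B : Flag (Face σ) => FlagAdjacent A B ∧ S ⊆ A ∧ S ⊆ B)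
      (h.flagOf γ) (h.flagOf (γ * ⟨δ, hδΓ⟩)) from this.2
  refine reflGroup_induction_right (p := fun δ => ∃ hδΓ : δ ∈ reflGroup α Set.univ,
      Relation.ReflTransGen (fun A B : Flag (Face σ) => FlagAdjacent A B ∧ S ⊆ A ∧ S ⊆ B)
      (h.flagOf γ) (h.flagOf (γ * ⟨δ, hδΓ⟩))) h.mul_self ⟨one_mem _, ?_⟩ ?_ hδ
  · have : γ * ⟨1, one_mem _⟩ = γ := mul_one γ
    rw [this]
  · rintro g hg a ha ⟨hgΓ, hpath⟩
    refine ⟨mul_mem hgΓ (h.gen a).2, hpath.tail ⟨?_, hS _ hg, hS _ (mul_mem hg (mem_reflGroup ha))⟩⟩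
    exact (h.flagAdjacent_iff ht).2 ⟨a, (mul_assoc γ ⟨g, hgΓ⟩ (h.gen a)).symm⟩

theorem flagConnected (h : IsStringGroup α σ ψ ε) (ht : IsThin α) : FlagConnected (Face σ) := by
  intro Φ Ψ
  obtain ⟨γ, rfl⟩ := h.exists_flagOf Φ
  obtain ⟨δ, rfl⟩ := h.exists_flagOf Ψ
  have := h.reflTransGen_flagOf ht (S := ∅) γ (fun _ _ => Set.empty_subset _) (γ⁻¹ * δ).2
    (γ⁻¹ * δ).2
  rw [show γ * ⟨_, (γ⁻¹ * δ).2⟩ = δ from mul_inv_cancel_left γ δ] at this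
  exact Relation.ReflTransGen.mono (fun A B hAB => hAB.1) _ _ this

/-- Strong flag-connectedness is the intersection property. -/
theorem stronglyFlagConnected_iff (h : IsStringGroup α σ ψ ε) (ht : IsThin α) :
    StronglyFlagConnected (Face σ) ↔ ∀ J : Set (Fin (m + 1)), ∀ g ∈ reflGroup α Set.univ,
      (∀ k ∉ J, g ∈ reflGroup α {k}ᶜ) → g ∈ reflGroup α J := by
  constructor
  · intro hs J g hg hgJ
    have key : ∀ Φ : Flag (Face σ), Relation.ReflTransGen
        (fun A B : Flag (Face σ) => FlagAdjacent A B ∧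
          (h.flagOf 1 : Set (Face σ)) ∩ h.flagOf ⟨g, hg⟩ ⊆ A ∧
          (h.flagOf 1 : Set (Face σ)) ∩ h.flagOf ⟨g, hg⟩ ⊆ B) (h.flagOf 1) Φ →
        ∃ γ : h.Refl, Φ = h.flagOf γ ∧ (γ : E) ∈ reflGroup α J := by
      intro Φ hΦ
      induction hΦ with
      | refl => exact ⟨1, rfl, one_mem _⟩
      | tail _ hstep ih =>
        obtain ⟨γ, rfl, hγ⟩ := ih
        obtain ⟨hadj, -, hsub⟩ := hstep
        rename_i B _
        obtain ⟨δ, rfl⟩ := h.exists_flagOf B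
        obtain ⟨k, rfl⟩ := (h.flagAdjacent_iff ht).1 hadj
        refine ⟨_, rfl, mul_mem hγ (mem_reflGroup ?_)⟩
        by_contra hkJ
        have hface : h.faceOf 1 k.succ.castSucc ∈ (h.flagOf (γ * h.gen k) : Set (Face σ)) := by
          refine hsub ⟨⟨_, rfl⟩, ?_⟩
          rw [faceOf_mem_flagOf, faceSet_succ_castSucc]
          simpa using hgJ k hkJ
        rw [faceOf_mem_flagOf, faceSet_succ_castSucc] at hface
        have hγk : (γ : E) ∈ reflGroup α {k}ᶜ :=
          reflGroup_mono (fun a ha hak => hkJ ((show a = k from hak) ▸ ha)) hγ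
        refine ht.notMem k ?_
        have := mul_mem (inv_mem hγk) hface
        simpa [gen] using this
    obtain ⟨γ, hγ, hγJ⟩ := key _ (hs (h.flagOf 1) (h.flagOf ⟨g, hg⟩))
    obtain rfl := h.flagOf_injective ht hγ
    exact hγJ
  · intro hint Φ Ψ
    obtain ⟨γ, rfl⟩ := h.exists_flagOf Φ
    obtain ⟨δ, rfl⟩ := h.exists_flagOf Ψ
    have hmem := hint {k | (γ : E)⁻¹ * δ ∉ reflGroup α {k}ᶜ} _ (γ⁻¹ * δ).2 fun k hk => by
      simpa using hk
    have := h.reflTransGen_flagOf ht (S := (h.flagOf γ : Set (Face σ)) ∩ h.flagOf δ) γ ?_ hmem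
      (γ⁻¹ * δ).2
    · rwa [show γ * ⟨_, (γ⁻¹ * δ).2⟩ = δ from mul_inv_cancel_left γ δ] at this
    · rintro η hη _ ⟨⟨r, rfl⟩, hr⟩
      rw [faceOf_mem_flagOf] at hr ⊢
      have : (γ : E)⁻¹ * (γ * η : h.Refl) = η := inv_mul_cancel_left _ _
      rw [this]
      have hsub : {k | (γ : E)⁻¹ * δ ∉ reflGroup α {k}ᶜ} ⊆ faceSet r := by
        intro a ha har
        exact ha ((mem_faceSet_iff_forall (h.inv_mul_mem_univ γ δ)).1 hr a har)
      exact reflGroup_mono hsub hη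

theorem isPolytope_iff (h : IsStringGroup α σ ψ ε) (ht : IsThin α) :
    IsPolytope (Face σ) Face.rank (m + 1) ↔ ∀ J : Set (Fin (m + 1)), ∀ g ∈ reflGroup α Set.univ,
      (∀ k ∉ J, g ∈ reflGroup α {k}ᶜ) → g ∈ reflGroup α J := by
  rw [← h.stronglyFlagConnected_iff ht]
  exact ⟨fun hp => hp.stronglyFlagConnected, fun hs => ⟨h.isPrePolytope ht, hs⟩⟩

end IsStringGroup

/-! ### Subgroups of direct products generated by diagonal elements -/

section Diagonal

variable {ι : Type*} [Finite ι] [DecidableEq ι] {G : ι → Type*} [∀ i, Group (G i)]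

/-- If for every `i`, with at most one exception, some power of a diagonal generator has its only
nontrivial coordinate at `i`, and this coordinate normally generates the `i`-th factor, then the
diagonal elements generate the direct product. -/
theorem closure_diagonal_eq_pi {κ : Type*} (x : ∀ i, κ → G i) (p : ι → Prop)
    (hp : ∀ i j, ¬ p i → ¬ p j → i = j)
    (hiso : ∀ i, p i → ∃ k n, (∀ j ≠ i, x j k ^ n = 1) ∧ ∀ N : Subgroup (G i),
      (∀ g ∈ Subgroup.closure (Set.range (x i)), ∀ y ∈ N, g * y * g⁻¹ ∈ N) →
        x i k ^ n ∈ N → ∀ l, x i l ∈ N) :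
    Subgroup.closure (Set.range fun l i => x i l) =
      Subgroup.pi Set.univ fun i => Subgroup.closure (Set.range (x i)) := by
  set H := Subgroup.closure (Set.range fun l i => x i l) with hH
  have hdiag : ∀ l, (fun i => x i l) ∈ H := fun l => Subgroup.subset_closure ⟨l, rfl⟩
  apply le_antisymm
  · rw [hH, Subgroup.closure_le]
    rintro _ ⟨l, rfl⟩ i -
    exact Subgroup.subset_closure ⟨l, rfl⟩
  have hsurj : ∀ i, ∀ g ∈ Subgroup.closure (Set.range (x i)), ∃ h ∈ H, h i = g := by
    intro i g hg
    have : H.map (Pi.evalMonoidHom G i) = Subgroup.closure (Set.range (x i)) := by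
      rw [hH, MonoidHom.map_closure, ← Set.range_comp]; rfl
    rw [← this] at hg
    exact hg
  have hsingle : ∀ i, p i → ∀ l, Pi.mulSingle i (x i l) ∈ H := by
    intro i hi
    obtain ⟨k, n, hk, hN⟩ := hiso i hi
    refine hN (H.comap (MonoidHom.mulSingle G i)) ?_ ?_
    · intro g hg y hy
      obtain ⟨h, hh, rfl⟩ := hsurj i g hg
      have hconj : Pi.mulSingle i (h i * y * (h i)⁻¹) = h * Pi.mulSingle i y * h⁻¹ := by
        ext j
        by_cases hj : j = i
        · subst hj; simp
        · simp [hj]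
      change Pi.mulSingle i (h i * y * (h i)⁻¹) ∈ H
      rw [hconj]
      exact mul_mem (mul_mem hh hy) (inv_mem hh)
    · have hpow : Pi.mulSingle i (x i k ^ n) = (fun i => x i k) ^ n := by
        ext j
        by_cases hj : j = i
        · subst hj; simp
        · simp [hj, hk j hj]
      change Pi.mulSingle i (x i k ^ n) ∈ H
      rw [hpow]
      exact pow_mem (hdiag k) n
  have hmap : ∀ i, (∀ l, Pi.mulSingle i (x i l) ∈ H) →
      (Subgroup.closure (Set.range (x i))).map (MonoidHom.mulSingle G i) ≤ H := by
    intro i hi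
    rw [MonoidHom.map_closure, Subgroup.closure_le]
    rintro _ ⟨_, ⟨l, rfl⟩, rfl⟩
    exact hi l
  rw [Subgroup.pi_le_iff]
  intro i
  by_cases hi : p i
  · exact hmap i (hsingle i hi)
  refine hmap i fun l => ?_
  -- the other factors are already in `H`, so they can be divided out of the diagonal generator
  have hrest : Function.update (fun j => x j l) i 1 ∈ H := by
    have hle : Subgroup.pi Set.univ (fun j => if j = i then ⊥ else
        Subgroup.closure (Set.range (x j))) ≤ H := by
      rw [Subgroup.pi_le_iff]
      intro j
      split_ifs with hj
      · simp
      · exact hmap j (hsingle j (by_contra fun hpj => hj (hp j i hpj hi)))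
    refine hle fun j _ => ?_
    by_cases hj : j = i
    · subst hj; simp
    · simpa [hj] using Subgroup.subset_closure (Set.mem_range_self l)
  have : Pi.mulSingle i (x i l) =
      (fun j => x j l) * (Function.update (fun j => x j l) i 1)⁻¹ := by
    ext j
    by_cases hj : j = i
    · subst hj; simp
    · simp [hj]
  rw [this]
  exact mul_mem (hdiag l) (inv_mem hrest)

/-- Modulo a normal subgroup that contains `b`, the order of `a` divides both 2 and 3. -/
theorem mem_of_conj_mem {H : Type*} [Group H] {N : Subgroup H} {a b : H}
    (hconj : a * b * a⁻¹ ∈ N) (hb : b ∈ N) (ha : a ^ 3 = 1) (hab : (a * b) ^ 2 = 1) : a ∈ N := by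
  have h2 : a ^ 2 = (b * (a * b * a⁻¹))⁻¹ := by
    rw [eq_inv_iff_mul_eq_one]
    calc a ^ 2 * (b * (a * b * a⁻¹)) = a * (a * b) ^ 2 * a⁻¹ := by
          simp only [pow_two, mul_assoc]
      _ = 1 := by rw [hab, mul_one, mul_inv_cancel]
  have h4 : a = (a ^ 2) ^ 2 := by
    rw [← pow_mul, show 2 * 2 = 3 + 1 from rfl, pow_succ, ha, one_mul]
  rw [h4]
  exact pow_mem (h2 ▸ inv_mem (mul_mem hb hconj)) 2

/-- The generators `y l` of a rotation group, all of order 3 except for `y k`, lie in every normal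
subgroup that contains `y k`. -/
theorem mem_of_generator_mem {H : Type*} [Group H] {m : ℕ} {y : Fin m → H} {N : Subgroup H}
    (hN : ∀ l, ∀ z ∈ N, y l * z * (y l)⁻¹ ∈ N)
    (hadj : ∀ k l : Fin m, (k : ℕ) + 1 = l → (y k * y l) ^ 2 = 1) {k : Fin m}
    (h3 : ∀ l ≠ k, y l ^ 3 = 1) (hk : y k ∈ N) (l : Fin m) : y l ∈ N := by
  have hup : ∀ n : ℕ, ∀ hn : (k : ℕ) + n < m, y ⟨k + n, hn⟩ ∈ N := by
    intro n
    induction n with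
    | zero => exact fun _ => hk
    | succ n ih =>
      intro hn
      have hz := ih (by omega)
      refine mem_of_conj_mem (hN _ _ hz) hz (h3 _ fun e => ?_) (mul_pow_eq_one_comm (hadj _ _ rfl))
      have := congrArg Fin.val e
      simp only at this
      omega
  have hdown : ∀ n : ℕ, ∀ hn : n ≤ k, y ⟨k - n, by omega⟩ ∈ N := by
    intro n
    induction n with
    | zero => exact fun _ => hk
    | succ n ih =>
      intro hn
      have hz := ih (by omega)
      refine mem_of_conj_mem (hN _ _ hz) hz (h3 _ fun e => ?_) (hadj _ _ ?_)
      · have := congrArg Fin.val e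
        simp only at this
        omega
      · simp only
        omega
  rcases le_total (k : ℕ) l with hkl | hkl
  · have := hup (l - k) (by omega)
    rwa [show (⟨k + (l - k), by omega⟩ : Fin m) = l from Fin.ext (by simp only; omega)] at this
  · have := hdown (k - l) (by omega)
    rwa [show (⟨k - (k - l), by omega⟩ : Fin m) = l from Fin.ext (by simp only; omega)] at this

/-- The mix of rotation groups whose `k`-th generators have orders dividing `s i k` is their direct
product, if for all `i` with at most one exception the order `s i (K i)` is prime to all other
`s j (K i)`, in the sense of `h1` and `h2`, and the other generators with index `i` have order 3. -/
theorem closure_rotations_eq_pi {m : ℕ} (y : ∀ i, Fin m → G i) (s : ι → Fin m → ℕ)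
    (hpow : ∀ i k, y i k ^ s i k = 1)
    (hadj : ∀ i, ∀ k l : Fin m, (k : ℕ) + 1 = l → (y i k * y i l) ^ 2 = 1) (p : ι → Prop)
    (hp : ∀ i j, ¬ p i → ¬ p j → i = j) (K : ι → Fin m) (n : ι → ℕ)
    (h1 : ∀ i, p i → ∀ j ≠ i, s j (K i) ∣ n i) (h2 : ∀ i, p i → n i * 3 % s i (K i) = 1)
    (h3 : ∀ i, p i → ∀ l ≠ K i, s i l = 3) :
    Subgroup.closure (Set.range fun l i => y i l) =
      Subgroup.pi Set.univ fun i => Subgroup.closure (Set.range (y i)) := by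
  refine closure_diagonal_eq_pi y p hp fun i hi => ⟨K i, n i, fun j hj => ?_, fun N hN hmem => ?_⟩
  · obtain ⟨c, hc⟩ := h1 i hi j hj
    rw [hc, pow_mul, hpow, one_pow]
  · refine mem_of_generator_mem (fun l z hz => hN _ (Subgroup.subset_closure ⟨l, rfl⟩) z hz)
      (hadj i) (fun l hl => h3 i hi l hl ▸ hpow i l) (k := K i) ?_
    have : y i (K i) = (y i (K i) ^ n i) ^ 3 := by
      rw [← pow_mul, ← Nat.div_add_mod (n i * 3) (s i (K i)), h2 i hi, pow_succ, pow_mul, hpow,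
        one_pow, one_mul]
    rw [this]
    exact pow_mem hmem 3

end Diagonal

/-! ### Signs and orders in the Coxeter groups -/

theorem neg_one_liftable {B : Type*} (M : CoxeterMatrix B) :
    M.IsLiftable fun _ : B => (-1 : ℤˣ) := fun _ _ => by simp

/-- The sign homomorphism, which is `-1` on reflections. -/
def sign (i : Convex4) : CoxGroup i →* ℤˣ :=
  (coxeterMatrix i).toCoxeterSystem.lift ⟨_, neg_one_liftable _⟩

theorem sign_rho (i : Convex4) (a : Fin 4) : sign i (rho i a) = -1 :=
  (coxeterMatrix i).toCoxeterSystem.lift_apply_simple (neg_one_liftable _) a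

theorem evenGroup_pair {κ E : Type*} [Group E] {α : κ → E} (hα : ∀ a, α a * α a = 1) (a b : κ) :
    evenGroup α {a, b} = Subgroup.zpowers (α a * α b) := by
  apply le_antisymm
  · rw [evenGroup, Subgroup.closure_le]
    have hba : α b * α a = (α a * α b)⁻¹ := by
      rw [mul_inv_rev, inv_eq_of_mul_eq_one_left (hα a), inv_eq_of_mul_eq_one_left (hα b)]
    rintro _ ⟨c, rfl | rfl, d, rfl | rfl, rfl⟩
    · simp [hα]
    · exact Subgroup.mem_zpowers _
    · rw [hba]
      exact inv_mem (Subgroup.mem_zpowers _)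
    · simp [hα]
  · rw [Subgroup.zpowers_le]
    exact mul_mem_evenGroup (by simp) (by simp)

theorem card_evenGroup_pair {κ E : Type*} [Group E] {α : κ → E} (hα : ∀ a, α a * α a = 1)
    (a b : κ) : Nat.card (evenGroup α {a, b}) = orderOf (α a * α b) := by
  rw [evenGroup_pair hα, Nat.card_zpowers]

set_option maxRecDepth 100000 in
theorem parabolicOrder_adjacent (i : Convex4) (k : Fin 3) :
    parabolicOrder i [k.castSucc, k.succ] = 2 * schlafli i k := by
  revert i k; decide +kernel

theorem orderOf_rotation (i : Convex4) (k : Fin 3) : orderOf (rotation i k) = schlafli i k := by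
  have h1 := card_parabolic_rho i (J := [k.castSucc, k.succ]) (by revert k; decide) (by simp)
  have h2 : parabolic (rho i) [k.castSucc, k.succ] = reflGroup (rho i) {k.castSucc, k.succ} := by
    rw [parabolic, reflGroup]
    congr 2
    ext a
    simp
  rw [h2, card_reflGroup (rho_mul_self i) (sign_rho i) ⟨k.castSucc, by simp⟩,
    card_evenGroup_pair (rho_mul_self i), parabolicOrder_adjacent] at h1
  exact Nat.eq_of_mul_eq_mul_left two_pos h1

theorem rotation_pow (i : Convex4) (k : Fin 3) : rotation i k ^ schlafli i k = 1 := by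
  rw [← orderOf_rotation, pow_orderOf_eq_one]

theorem rotationGroup_eq (i : Convex4) : rotationGroup i = evenGroup (rho i) Set.univ :=
  closure_range_mul_succ (rho_mul_self i)

/-- The order of the rotation group of `P_i`. -/
def rotationOrder : Convex4 → ℕ
  | P₁ => 60
  | P₂ | P₅ => 192
  | P₃ | P₆ => 7200
  | P₄ => 576

theorem card_rotationGroup (i : Convex4) : Nat.card (rotationGroup i) = rotationOrder i := by
  have h := card_reflGroup (rho_mul_self i) (sign_rho i) (J := Set.univ) ⟨0, Set.mem_univ _⟩
  rw [reflGroup, Set.image_univ, closure_range_rho, Subgroup.card_top, card_coxGroup,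
    ← rotationGroup_eq] at h
  rw [show coxOrder i = 2 * rotationOrder i by cases i <;> rfl] at h
  exact (Nat.eq_of_mul_eq_mul_left two_pos h).symm

/-! ### Vertex-figures and facets -/

/-- Vertex-figures and facets. -/
inductive Side : Type
  | vertexFigure | facet
  deriving DecidableEq

namespace Side

instance : Fintype Side where
  elems := {vertexFigure, facet}
  complete := by intro v; cases v <;> decide

/-- The nodes of the Coxeter diagram that belong to the vertex-figure or to the facet. -/
def emb : Side → Fin 3 ↪ Fin 4
  | vertexFigure => Fin.succEmb 3
  | facet => Fin.castSuccEmb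

/-- The node of the diagram that does not. -/
def omitted : Side → Fin 4
  | vertexFigure => 0
  | facet => 3

/-- A representative of the polytopes with the same vertex-figure or facet. -/
def rep : Side → Convex4 → Convex4
  | vertexFigure, P₅ => P₁
  | vertexFigure, P₆ => P₁
  | facet, P₂ => P₁
  | facet, P₃ => P₁
  | _, i => i

/-- The nodes as a list. -/
def nodes (v : Side) : List (Fin 4) := [v.emb 0, v.emb 1, v.emb 2]

theorem range_emb (v : Side) : Set.range v.emb = {v.omitted}ᶜ := by
  ext a
  have : (∃ b, v.emb b = a) ↔ a ≠ v.omitted := by revert v a; decide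
  exact this

theorem mem_nodes_iff (v : Side) (a : Fin 4) : a ∈ v.nodes ↔ ∃ b, v.emb b = a := by
  revert v a; decide

/-- The Coxeter matrix of the vertex-figure or facet of `P_i`. Its group is a separate object; that
it is the subgroup generated by three of the reflections of `P_i` is `toCox_injective`. -/
def matrix (v : Side) (i : Convex4) : CoxeterMatrix (Fin 3) where
  M := Matrix.of fun a b => coxeterMatrix i (v.emb a) (v.emb b)
  isSymm := by
    ext a b
    exact (coxeterMatrix i).symmetric _ _
  diagonal a := (coxeterMatrix i).diagonal _
  off_diagonal a b hab := (coxeterMatrix i).off_diagonal _ _ fun e => hab (v.emb.injective e)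

theorem matrix_rep (v : Side) (i : Convex4) (a b : Fin 3) :
    v.matrix (v.rep i) a b = coxeterMatrix i (v.emb a) (v.emb b) := by
  cases v <;> cases i <;> fin_cases a <;> fin_cases b <;> rfl

/-- The Coxeter group of the vertex-figure or facet of `P_i`. -/
abbrev Group (v : Side) (i : Convex4) : Type := (v.matrix i).Group

/-- The generating reflections. -/
abbrev gen (v : Side) (i : Convex4) (a : Fin 3) : v.Group i := (v.matrix i).simple a

theorem gen_mul_pow (v : Side) (i : Convex4) (a b : Fin 3) :
    (v.gen i a * v.gen i b) ^ v.matrix i a b = 1 :=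
  (v.matrix i).toCoxeterSystem.simple_mul_simple_pow a b

theorem gen_mul_self (v : Side) (i : Convex4) (a : Fin 3) : v.gen i a * v.gen i a = 1 := by
  simpa [(v.matrix i).diagonal] using gen_mul_pow v i a a

theorem rho_emb_liftable (v : Side) (i : Convex4) :
    (v.matrix (v.rep i)).IsLiftable fun a => rho i (v.emb a) := fun a b => by
  rw [matrix_rep]
  exact rho_mul_pow i _ _

/-- The homomorphism onto the parabolic subgroup of the vertex or facet. It starts from the group of
the representative, so that polytopes with the same vertex-figures or facets share its domain. -/
def toCox (v : Side) (i : Convex4) : v.Group (v.rep i) →* CoxGroup i :=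
  (v.matrix (v.rep i)).toCoxeterSystem.lift ⟨_, v.rho_emb_liftable i⟩

theorem toCox_gen (v : Side) (i : Convex4) (a : Fin 3) :
    v.toCox i (v.gen (v.rep i) a) = rho i (v.emb a) :=
  (v.matrix (v.rep i)).toCoxeterSystem.lift_apply_simple (v.rho_emb_liftable i) a

/-- The reflections of the vertex-figure or facet, indexed by nodes of the diagram of the polytope.
-/
noncomputable def extendedGen (v : Side) (i : Convex4) : Fin 4 → v.Group i :=
  Function.extend v.emb (v.gen i) fun _ => 1

theorem extendedGen_emb (v : Side) (i : Convex4) (a : Fin 3) :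
    v.extendedGen i (v.emb a) = v.gen i a :=
  v.emb.injective.extend_apply _ _ a

theorem isWeightAction (v : Side) (i : Convex4) :
    IsWeightAction i v.nodes (v.extendedGen (v.rep i)) ((weightHom i).comp (v.toCox i)) where
  rel a ha t ht := by
    obtain ⟨a, rfl⟩ := (v.mem_nodes_iff a).1 ha
    obtain ⟨t, rfl⟩ := (v.mem_nodes_iff t).1 ht
    rw [extendedGen_emb, extendedGen_emb, ← matrix_rep]
    exact gen_mul_pow v _ a t
  apply a ha := by
    obtain ⟨a, rfl⟩ := (v.mem_nodes_iff a).1 ha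
    rw [extendedGen_emb, MonoidHom.comp_apply, toCox_gen, weightHom_rho]

theorem nodes_sublist (v : Side) : v.nodes.Sublist [0, 1, 2, 3] := by revert v; decide

theorem parabolic_extendedGen (v : Side) (i : Convex4) :
    parabolic (v.extendedGen i) v.nodes = ⊤ := by
  rw [← (v.matrix i).toCoxeterSystem.subgroup_closure_range_simple, parabolic]
  congr 1
  ext g
  constructor
  · rintro ⟨a, ha, rfl⟩
    obtain ⟨a, rfl⟩ := (v.mem_nodes_iff a).1 ha
    exact ⟨a, (v.extendedGen_emb i a).symm⟩
  · rintro ⟨a, rfl⟩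
    exact ⟨v.emb a, (v.mem_nodes_iff _).2 ⟨a, rfl⟩, v.extendedGen_emb i a⟩

/-- The Coxeter group of the vertex-figure or facet embeds in the Coxeter group of the polytope. -/
theorem toCox_injective (v : Side) (i : Convex4) : Function.Injective (v.toCox i) := by
  rw [injective_iff_map_eq_one]
  intro g hg
  refine (v.isWeightAction i).eq_one_of_apply_eq_one v.nodes_sublist (by simp [nodes])
    (v.parabolic_extendedGen _ ▸ Subgroup.mem_top g) ?_
  rw [MonoidHom.comp_apply, hg, map_one]

/-- The order of the rotation group of the vertex-figure or facet of `P_i`, where `i` is a value of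
`rep`. -/
def rotOrder : Convex4 → ℕ
  | P₁ => 12
  | P₂ | P₄ | P₅ => 24
  | P₃ | P₆ => 60

set_option maxRecDepth 100000 in
theorem parabolicOrder_nodes (v : Side) (i : Convex4) :
    parabolicOrder i v.nodes = 2 * rotOrder (v.rep i) := by
  revert v i; decide +kernel

theorem card_evenGroup_gen (v : Side) (i : Convex4) :
    Nat.card (evenGroup (v.gen (v.rep i)) Set.univ) = rotOrder (v.rep i) := by
  have h := card_reflGroup (v.gen_mul_self (v.rep i)) (J := Set.univ)
    (ε := (sign i).comp (v.toCox i))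
    (fun a => by rw [MonoidHom.comp_apply, toCox_gen, sign_rho]) ⟨0, Set.mem_univ _⟩
  rw [reflGroup, Set.image_univ] at h
  rw [show Subgroup.closure (Set.range (v.gen (v.rep i))) = ⊤ from
    (v.matrix _).toCoxeterSystem.subgroup_closure_range_simple, ← parabolic_extendedGen,
    (v.isWeightAction i).card_parabolic_eq v.nodes_sublist (by simp [nodes]),
    parabolicOrder_nodes] at h
  exact (Nat.eq_of_mul_eq_mul_left two_pos h).symm

/-- The index of a rotation of the vertex-figure or facet whose order is prime to those of the
corresponding rotations of the other types. The type `P₁` has none, and `0` is a default. -/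
def isolating : Side → Convex4 → Fin 2
  | vertexFigure, P₂ | vertexFigure, P₃ | facet, P₄ => 1
  | _, _ => 0

end Side

/-- For `i ≠ P₁`, a common multiple of the orders that the isolating rotation has in the other
polytopes. As the exponents `15`, `12` and `3` are inverse to `3` modulo the orders `4`, `5` and
`4`, the isolating rotation is the cube of its power with this exponent. -/
def isolatingExponent : Convex4 → ℕ
  | P₁ => 0
  | P₂ | P₅ => 15
  | P₃ | P₆ => 12
  | P₄ => 3

/-- The index of a rotation whose order is prime to the orders of the corresponding rotations of the
other five polytopes. The simplex has none, and `0` is a default. -/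
def isolating : Convex4 → Fin 3
  | P₂ | P₃ => 2
  | P₄ => 1
  | _ => 0

/-! ### The mixes of the vertex-figures and of the facets -/

/-- The group that contains the mix of the `P_i`, `i ∈ I`. -/
abbrev MixCoxGroup (I : Finset Convex4) : Type := ∀ i : I, CoxGroup i

/-- The tuples of corresponding reflections. -/
def mixRho (I : Finset Convex4) (a : Fin 4) : MixCoxGroup I := fun i => rho i a

theorem mixRho_mul_self (I : Finset Convex4) (a : Fin 4) : mixRho I a * mixRho I a = 1 :=
  funext fun i => rho_mul_self i a

namespace Side

/-- The index, as a rotation of the polytope, of a rotation of the vertex-figure or facet. -/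
def edge : Side → Fin 2 → Fin 3
  | vertexFigure => Fin.succ
  | facet => Fin.castSucc

/-- The index, in the vertex-figure or facet, of the rotation `ρ_1 ρ_2` that belongs to both. -/
def inner : Side → Fin 2
  | vertexFigure => 0
  | facet => 1

theorem emb_inner_castSucc (v : Side) : v.emb v.inner.castSucc = 1 := by revert v; decide

theorem emb_inner_succ (v : Side) : v.emb v.inner.succ = 2 := by revert v; decide

theorem matrix_castSucc_succ (v : Side) (d : Convex4) (k : Fin 2) :
    v.matrix d k.castSucc k.succ = schlafli d (v.edge k) := by
  cases v <;> cases d <;> fin_cases k <;> rfl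

theorem matrix_zero_two (v : Side) (d : Convex4) : v.matrix d 0 2 = 2 := by
  cases v <;> cases d <;> rfl

/-- The rotations of the vertex-figure or facet. -/
def rot (v : Side) (d : Convex4) (k : Fin 2) : v.Group d := v.gen d k.castSucc * v.gen d k.succ

theorem closure_range_rot (v : Side) (d : Convex4) :
    Subgroup.closure (Set.range (v.rot d)) = evenGroup (v.gen d) Set.univ :=
  closure_range_mul_succ (v.gen_mul_self d)

theorem toCox_rot_inner (v : Side) (i : Convex4) :
    v.toCox i (v.rot (v.rep i) v.inner) = rho i 1 * rho i 2 := by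
  rw [rot, map_mul, toCox_gen, toCox_gen, emb_inner_castSucc, emb_inner_succ]

/-- The types of the vertex-figures or facets that occur. -/
def types (v : Side) (I : Finset Convex4) : Finset Convex4 := I.image v.rep

variable (v : Side) (I : Finset Convex4)

/-- The type of the vertex-figure or facet of a member of `I`. -/
def typeOf (i : I) : v.types I := ⟨v.rep i, Finset.mem_image_of_mem _ i.2⟩

theorem typeOf_surjective : Function.Surjective (v.typeOf I) := by
  rintro ⟨d, hd⟩
  obtain ⟨i, hi, rfl⟩ := Finset.mem_image.1 hd
  exact ⟨⟨i, hi⟩, rfl⟩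

/-- A tuple with one entry for each type of vertex-figure or facet gives a tuple with one entry for
each polytope. -/
def spread : (∀ d : v.types I, v.Group d) →* MixCoxGroup I :=
  MonoidHom.pi fun i : I => (v.toCox i).comp
    (Pi.evalMonoidHom (fun d : v.types I => v.Group d) (v.typeOf I i))

theorem spread_apply (x : ∀ d : v.types I, v.Group d) (i : I) :
    v.spread I x i = v.toCox i (x (v.typeOf I i)) := rfl

theorem spread_injective : Function.Injective (v.spread I) := fun x y h => by
  funext d
  obtain ⟨i, rfl⟩ := v.typeOf_surjective I d
  exact v.toCox_injective i (congrFun h i)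

theorem dvd_isolatingExponent {i j : Convex4} (h : v.rep i ≠ P₁) (hij : v.rep j ≠ v.rep i) :
    schlafli (v.rep j) (v.edge (v.isolating (v.rep i))) ∣ isolatingExponent (v.rep i) := by
  revert v i j; decide

theorem isolatingExponent_mod {i : Convex4} (h : v.rep i ≠ P₁) :
    isolatingExponent (v.rep i) * 3 % schlafli (v.rep i) (v.edge (v.isolating (v.rep i))) = 1 := by
  revert v i; decide

theorem schlafli_eq_three {i : Convex4} (h : v.rep i ≠ P₁) {l : Fin 2}
    (hl : l ≠ v.isolating (v.rep i)) : schlafli (v.rep i) (v.edge l) = 3 := by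
  revert v i l; decide

/-- The rotation group of the mix of the vertex-figures or facets is the direct product of those of
the different types. -/
theorem closure_range_rot_eq_pi :
    Subgroup.closure (Set.range fun k (d : v.types I) => v.rot d k) =
      Subgroup.pi Set.univ fun d : v.types I => evenGroup (v.gen d) Set.univ := by
  simp_rw [← closure_range_rot]
  refine closure_rotations_eq_pi (fun d : v.types I => v.rot d)
    (fun d k => schlafli d (v.edge k)) (fun d k => ?_) (fun d k l hkl => ?_)
    (fun d => (d : Convex4) ≠ P₁) (fun c d hc hd => ?_) (fun d => v.isolating d)
    (fun d => isolatingExponent d) (fun d hd c hcd => ?_) (fun d hd => ?_) fun d hd l hl => ?_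
  · rw [← matrix_castSucc_succ]
    exact gen_mul_pow v d _ _
  · obtain rfl : k = 0 := by omega
    obtain rfl : l = 1 := by ext; exact hkl.symm
    have : v.rot d 0 * v.rot d 1 = v.gen d 0 * v.gen d 2 := by
      change v.gen d 0 * v.gen d 1 * (v.gen d 1 * v.gen d 2) = _
      rw [mul_assoc, ← mul_assoc (v.gen d 1), gen_mul_self, one_mul]
    have h2 := v.gen_mul_pow d 0 2
    rwa [matrix_zero_two, ← this] at h2
  · exact Subtype.ext ((not_not.1 hc).trans (not_not.1 hd).symm)
  · obtain ⟨i, rfl⟩ := v.typeOf_surjective I d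
    obtain ⟨j, rfl⟩ := v.typeOf_surjective I c
    exact v.dvd_isolatingExponent hd fun e => hcd (Subtype.ext e)
  · obtain ⟨i, rfl⟩ := v.typeOf_surjective I d
    exact v.isolatingExponent_mod hd
  · obtain ⟨i, rfl⟩ := v.typeOf_surjective I d
    exact v.schlafli_eq_three hd hl

theorem evenGroup_mixRho_compl :
    evenGroup (mixRho I) {v.omitted}ᶜ =
      (Subgroup.pi Set.univ fun d : v.types I => evenGroup (v.gen d) Set.univ).map
        (v.spread I) := by
  have hcomp : mixRho I ∘ v.emb = fun a => v.spread I fun d => v.gen d a := by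
    funext a i
    exact (v.toCox_gen i a).symm
  rw [← range_emb, ← Set.image_univ, evenGroup_image, hcomp, ← closure_range_rot_eq_pi,
    ← map_evenGroup, ← closure_range_mul_succ]
  · rfl
  · exact fun a => funext fun d => v.gen_mul_self d a

/-- The order of the rotation group of the vertex-figures or facets of the mix. -/
theorem card_evenGroup_mixRho_compl :
    Nat.card (evenGroup (mixRho I) {v.omitted}ᶜ) = ∏ d ∈ v.types I, rotOrder d := by
  rw [evenGroup_mixRho_compl, ← Nat.card_congr
    (Subgroup.equivMapOfInjective _ _ (v.spread_injective I)).toEquiv,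
    ← Finset.prod_coe_sort]
  refine (Nat.card_congr (Equiv.Set.univPi _)).trans (Nat.card_pi.trans ?_)
  refine Finset.prod_congr rfl fun d _ => ?_
  obtain ⟨i, rfl⟩ := v.typeOf_surjective I d
  exact v.card_evenGroup_gen i

/-- The tuple that is the rotation `ρ_1 ρ_2` in the polytopes with certain types of vertex-figures
or facets, and trivial in the others. -/
theorem ite_mem_evenGroup (q : Convex4 → Prop) [DecidablePred q] :
    (fun i : I => if q (v.rep i) then rho i 1 * rho i 2 else 1) ∈
      evenGroup (mixRho I) {v.omitted}ᶜ := by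
  rw [evenGroup_mixRho_compl]
  refine ⟨fun d => if q d then v.rot d v.inner else 1, fun d _ => ?_, ?_⟩
  · dsimp only
    split_ifs
    · exact mul_mem_evenGroup (Set.mem_univ _) (Set.mem_univ _)
    · exact one_mem (evenGroup (v.gen d) Set.univ)
  · funext i
    rw [spread_apply]
    change v.toCox i (if q (v.rep i) then v.rot (v.rep i) v.inner else 1) = _
    split_ifs
    · exact v.toCox_rot_inner i
    · exact map_one _

/-- An element of the rotation group of the vertex-figure or facet of the mix acts in the same way
in any two polytopes with the same vertex-figures or facets. -/
theorem eq_pow_of_rep_eq {g : MixCoxGroup I} (hg : g ∈ evenGroup (mixRho I) {v.omitted}ᶜ) {i j : I}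
    (hij : v.rep i = v.rep j) {e : ℤ} (he : g i = (rho i 1 * rho i 2) ^ e) :
    g j = (rho j 1 * rho j 2) ^ e := by
  rw [evenGroup_mixRho_compl] at hg
  obtain ⟨x, -, rfl⟩ := hg
  have key : ∀ c d : v.types I, c = d → x c = v.rot c v.inner ^ e → x d = v.rot d v.inner ^ e := by
    rintro c _ rfl h
    exact h
  have hi : x (v.typeOf I i) = v.rot (v.rep i) v.inner ^ e := by
    apply v.toCox_injective i
    rw [map_zpow, toCox_rot_inner]
    exact he
  have hj := key _ (v.typeOf I j) (Subtype.ext hij) hi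
  rw [spread_apply, hj]
  change v.toCox j (v.rot (v.rep j) v.inner ^ e) = _
  rw [map_zpow, toCox_rot_inner]

end Side

/-! ### The rotation groups of the mixes -/

theorem coxeterMatrix_eq_two (i : Convex4) {a b : Fin 4} (h : (a : ℕ) + 2 ≤ b) :
    coxeterMatrix i a b = 2 := by
  fin_cases a <;> fin_cases b <;> first | (simp at h; done) | (cases i <;> rfl)

theorem rho_comm (i : Convex4) {a b : Fin 4} (h : (a : ℕ) + 2 ≤ b) :
    rho i a * rho i b = rho i b * rho i a := by
  have h2 := rho_mul_pow i a b
  rw [coxeterMatrix_eq_two i h, pow_two, mul_eq_one_iff_eq_inv, mul_inv_rev,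
    inv_eq_of_mul_eq_one_left (rho_mul_self i a),
    inv_eq_of_mul_eq_one_left (rho_mul_self i b)] at h2
  exact h2

theorem rotation_mul_pow_two (i : Convex4) {k l : Fin 3} (h : (k : ℕ) + 1 = l) :
    (rotation i k * rotation i l) ^ 2 = 1 := by
  have hkl : k.succ = l.castSucc := Fin.ext h
  have hmul : rotation i k * rotation i l = rho i k.castSucc * rho i l.succ := by
    change rho i k.castSucc * rho i k.succ * (rho i l.castSucc * rho i l.succ) = _
    rw [hkl, mul_assoc, ← mul_assoc (rho i l.castSucc), rho_mul_self, one_mul]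
  have h2 := rho_mul_pow i k.castSucc l.succ
  rwa [coxeterMatrix_eq_two i (by simp; omega), ← hmul] at h2

theorem closure_range_rotationGen (i : Convex4) :
    Subgroup.closure (Set.range (rotationGen i)) = ⊤ := by
  refine (congrArg Subgroup.closure (Set.ext fun g => ?_)).trans
    (Subgroup.closure_closure_coe_preimage (k := Set.range (rotation i)))
  constructor
  · rintro ⟨k, rfl⟩
    exact ⟨k, rfl⟩
  · rintro ⟨k, hk⟩
    exact ⟨k, Subtype.ext hk⟩

theorem schlafli_dvd_isolatingExponent {i j : Convex4} (hi : i ≠ P₁) (hij : j ≠ i) :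
    schlafli j (isolating i) ∣ isolatingExponent i := by
  revert i j; decide

theorem isolatingExponent_mod {i : Convex4} (hi : i ≠ P₁) :
    isolatingExponent i * 3 % schlafli i (isolating i) = 1 := by
  revert i; decide

theorem schlafli_eq_three {i : Convex4} (hi : i ≠ P₁) {l : Fin 3} (hl : l ≠ isolating i) :
    schlafli i l = 3 := by
  revert i l; decide

theorem mixRotationGroup_eq_top (I : Finset Convex4) : mixRotationGroup I = ⊤ := by
  refine (closure_rotations_eq_pi (fun i : I => rotationGen i) (fun i k => schlafli i k)
    (fun i k => Subtype.ext (rotation_pow i k))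
    (fun i k l hkl => Subtype.ext (rotation_mul_pow_two i hkl)) (fun i => (i : Convex4) ≠ P₁)
    (fun i j hi hj => Subtype.ext ((not_not.1 hi).trans (not_not.1 hj).symm))
    (fun i => isolating i) (fun i => isolatingExponent i)
    (fun i hi j hij => schlafli_dvd_isolatingExponent hi fun e => hij (Subtype.ext e))
    (fun i hi => isolatingExponent_mod hi) fun i hi l hl => schlafli_eq_three hi hl).trans ?_
  refine eq_top_iff.2 fun g _ i _ => ?_
  dsimp only
  rw [closure_range_rotationGen]
  exact Subgroup.mem_top _

theorem card_mixRotationGroup (I : Finset Convex4) :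
    Nat.card (mixRotationGroup I) = ∏ i ∈ I, rotationOrder i := by
  rw [mixRotationGroup_eq_top, Subgroup.card_top, Nat.card_pi]
  exact (Fintype.prod_congr _ _ fun i : I => card_rotationGroup i).trans
    (Finset.prod_coe_sort I rotationOrder)

/-- The inclusion of the rotation group of the mix in the product of the Coxeter groups. -/
def mixInclusion (I : Finset Convex4) : mixRotationGroup I →* MixCoxGroup I :=
  (MonoidHom.piMap fun i : I => (rotationGroup i).subtype).comp (mixRotationGroup I).subtype

theorem isStringGroup {I : Finset Convex4} (i : I) :
    IsStringGroup (mixRho I) (mixRotationGen I) (mixInclusion I)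
      ((sign i).comp (Pi.evalMonoidHom _ i)) where
  two_le := by norm_num
  mul_self := mixRho_mul_self I
  comm a b h := funext fun j => rho_comm j h
  sign a := sign_rho i a
  injective g g' h := Subtype.ext (funext fun j => Subtype.ext (congrFun h j))
  map_gen k := rfl
  closure_gen := by
    refine (congrArg Subgroup.closure (Set.ext fun g => ?_)).trans
      (Subgroup.closure_closure_coe_preimage
        (k := Set.range fun k : Fin 3 => fun i : I => rotationGen i k))
    constructor
    · rintro ⟨k, rfl⟩
      exact ⟨k, rfl⟩
    · rintro ⟨k, hk⟩
      exact ⟨k, Subtype.ext hk⟩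

/-! ### Intersections of parabolic subgroups in the mixes -/

theorem reflGroup_empty {κ E : Type*} [Group E] (α : κ → E) : reflGroup α ∅ = ⊥ := by
  rw [reflGroup, Set.image_empty, Subgroup.closure_empty]

theorem mem_reflGroup_inter {i : Convex4} {J K : Set (Fin 4)} {g : CoxGroup i}
    (hJ : g ∈ reflGroup (rho i) J) (hK : g ∈ reflGroup (rho i) K) :
    g ∈ reflGroup (rho i) (J ∩ K) := by
  refine mem_closure_rho_of_forall fun k hk => ?_
  by_cases h : k ∈ J
  · exact reflGroup_mono (fun a ha (e : a = k) => hk ⟨h, e ▸ ha⟩) hK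
  · exact reflGroup_mono (fun a ha (e : a = k) => h (e ▸ ha)) hJ

section Intersection

variable {I : Finset Convex4} {J K : Set (Fin 4)} {g : MixCoxGroup I}

theorem apply_mem_reflGroup (hg : g ∈ reflGroup (mixRho I) J) (i : I) :
    g i ∈ reflGroup (rho i) J := by
  have := Subgroup.mem_map_of_mem (Pi.evalMonoidHom _ i) hg
  rwa [map_reflGroup] at this

theorem apply_mem_reflGroup_of_forall (hg : ∀ k ∉ J, g ∈ reflGroup (mixRho I) {k}ᶜ) (i : I) :
    g i ∈ reflGroup (rho i) J :=
  mem_closure_rho_of_forall fun k hk => apply_mem_reflGroup (hg k hk) i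

theorem sign_apply_eq (hg : g ∈ reflGroup (mixRho I) J) (i j : I) :
    sign i (g i) = sign j (g j) := by
  have hgen : ∀ a, sign i (mixRho I a i) = sign j (mixRho I a j) := fun a => by
    rw [mixRho, mixRho, sign_rho, sign_rho]
  refine reflGroup_induction_right (p := fun g => sign i (g i) = sign j (g j)) (mixRho_mul_self I)
    (by rw [Pi.one_apply, Pi.one_apply, map_one, map_one]) (fun g _ a _ h => ?_) hg
  rw [Pi.mul_apply, Pi.mul_apply, map_mul, map_mul, h, hgen]

/-- As all components of an element of the mix have the same sign, they cannot be trivial in some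
components and a reflection in others. -/
theorem mem_reflGroup_singleton_of_apply (hg : g ∈ reflGroup (mixRho I) J) {k : Fin 4}
    (hk : ∀ i : I, g i ∈ reflGroup (rho i) {k}) : g ∈ reflGroup (mixRho I) {k} := by
  by_cases h1 : ∃ i : I, g i = 1
  · obtain ⟨i, hi⟩ := h1
    have : g = 1 := funext fun j =>
      (mem_reflGroup_singleton (rho_mul_self j) (hk j)).resolve_right fun hj => by
        have hs := sign_apply_eq hg i j
        rw [hi, hj, map_one, sign_rho] at hs
        exact absurd hs (by decide)
    exact this ▸ one_mem _
  · have : g = mixRho I k := funext fun j =>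
      (mem_reflGroup_singleton (rho_mul_self j) (hk j)).resolve_left fun hj => h1 ⟨j, hj⟩
    exact this ▸ mem_reflGroup rfl

theorem mixRho_notMem (i : I) (k : Fin 4) : mixRho I k ∉ reflGroup (mixRho I) {k}ᶜ := fun h =>
  rho_notMem i k (apply_mem_reflGroup h i)

theorem mixRho_comm_of_far {c : Fin 4} (hK : ∀ a ∈ K, (a : ℕ) + 2 ≤ c ∨ (c : ℕ) + 2 ≤ a) :
    ∀ a ∈ ({c} : Set (Fin 4)), ∀ b ∈ K, mixRho I a * mixRho I b = mixRho I b * mixRho I a := by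
  rintro _ rfl a ha
  rcases hK a ha with h | h
  · exact (funext fun i : I => rho_comm i h).symm
  · exact funext fun i : I => rho_comm i h

/-- The intersection property for a pair `{c, b}`, where the node `c` of the diagram is adjacent to
no node in `K`: when the reflection `c` has been split off, only the components of `{b}` remain. -/
theorem mem_reflGroup_pair_of_apply {c b : Fin 4} (hK : ∀ a ∈ K, (a : ℕ) + 2 ≤ c ∨ (c : ℕ) + 2 ≤ a)
    (hg : g ∈ reflGroup (mixRho I) ({c} ∪ K))
    (happ : ∀ i : I, g i ∈ reflGroup (rho i) {c, b}) : g ∈ reflGroup (mixRho I) {c, b} := by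
  obtain ⟨u, hu, l, hl, rfl⟩ := exists_mul_of_mem_reflGroup_union (mixRho_mul_self I)
    (mixRho_comm_of_far hK) hg
  refine mul_mem (reflGroup_mono (by simp) hu)
    (reflGroup_mono (J := {b}) (by simp) (mem_reflGroup_singleton_of_apply hl fun i => ?_))
  have hli : l i ∈ reflGroup (rho i) {c, b} := by
    have := mul_mem (inv_mem (reflGroup_mono (K := {c, b}) (by simp) (apply_mem_reflGroup hu i)))
      (happ i)
    rwa [Pi.mul_apply, inv_mul_cancel_left] at this
  refine reflGroup_mono ?_ (mem_reflGroup_inter hli (apply_mem_reflGroup hl i))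
  rintro a ⟨rfl | h, ha⟩
  · rcases hK a ha with h | h <;> omega
  · exact h

/-- If the node `c` of the diagram is adjacent to no node in `K`, then an element of the parabolic
subgroup of `{c} ∪ K` that avoids the reflection `c` belongs to that of `K`. -/
theorem mem_reflGroup_of_mem_compl {c : Fin 4}
    (hK : ∀ a ∈ K, (a : ℕ) + 2 ≤ c ∨ (c : ℕ) + 2 ≤ a) (i : I)
    (hg : g ∈ reflGroup (mixRho I) ({c} ∪ K)) (hc : g ∈ reflGroup (mixRho I) {c}ᶜ) :
    g ∈ reflGroup (mixRho I) K := by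
  obtain ⟨u, hu, l, hl, rfl⟩ := exists_mul_of_mem_reflGroup_union (mixRho_mul_self I)
    (mixRho_comm_of_far hK) hg
  have hcK : K ⊆ {c}ᶜ := fun a ha (e : a = c) => by rcases hK a ha with h | h <;> omega
  have hl' := reflGroup_mono hcK hl
  rcases mem_reflGroup_singleton (mixRho_mul_self I) hu with rfl | rfl
  · rwa [one_mul]
  · exact absurd ((Subgroup.mul_mem_cancel_right _ hl').1 hc) (mixRho_notMem i c)

theorem compl_one_eq : ({1}ᶜ : Set (Fin 4)) = {0} ∪ {2, 3} := by
  ext a; fin_cases a <;> simp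

theorem compl_two_eq : ({2}ᶜ : Set (Fin 4)) = {3} ∪ {0, 1} := by
  ext a; fin_cases a <;> simp

theorem eq_one_of_forall (hg : ∀ k, g ∈ reflGroup (mixRho I) {k}ᶜ) : g = 1 := funext fun i => by
  have := apply_mem_reflGroup_of_forall (J := ∅) (fun k _ => hg k) i
  rwa [reflGroup_empty, Subgroup.mem_bot] at this

theorem mem_reflGroup_zero_two (h1 : g ∈ reflGroup (mixRho I) {1}ᶜ)
    (h3 : g ∈ reflGroup (mixRho I) {3}ᶜ) : g ∈ reflGroup (mixRho I) {0, 2} := by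
  refine mem_reflGroup_pair_of_apply (K := {2, 3}) (by simp) (compl_one_eq ▸ h1) ?_
  refine apply_mem_reflGroup_of_forall fun k hk => ?_
  fin_cases k <;> simp_all

theorem mem_reflGroup_zero_three (h1 : g ∈ reflGroup (mixRho I) {1}ᶜ)
    (h2 : g ∈ reflGroup (mixRho I) {2}ᶜ) : g ∈ reflGroup (mixRho I) {0, 3} := by
  refine mem_reflGroup_pair_of_apply (K := {2, 3}) (by simp) (compl_one_eq ▸ h1) ?_
  refine apply_mem_reflGroup_of_forall fun k hk => ?_
  fin_cases k <;> simp_all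

theorem mem_reflGroup_one_three (h0 : g ∈ reflGroup (mixRho I) {0}ᶜ)
    (h2 : g ∈ reflGroup (mixRho I) {2}ᶜ) : g ∈ reflGroup (mixRho I) {1, 3} := by
  rw [Set.pair_comm]
  refine mem_reflGroup_pair_of_apply (K := {0, 1}) (by simp) (compl_two_eq ▸ h2) ?_
  refine apply_mem_reflGroup_of_forall fun k hk => ?_
  fin_cases k <;> simp_all

theorem isThin (i : I) : IsThin (mixRho I) where
  eq_one _ _ hg := eq_one_of_forall hg
  mem_of_adjacent k g _ hg := by
    fin_cases k
    · refine reflGroup_mono (fun a ha => ?_) (hg 1 (by simp))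
      fin_cases a <;> simp_all
    · refine reflGroup_mono (fun a ha => ?_)
        (mem_reflGroup_one_three (hg 0 (by simp)) (hg 2 (by simp)))
      fin_cases a <;> simp_all
    · refine reflGroup_mono (fun a ha => ?_)
        (mem_reflGroup_zero_two (hg 1 (by simp)) (hg 3 (by simp)))
      fin_cases a <;> simp_all
    · refine reflGroup_mono (fun a ha => ?_) (hg 2 (by simp))
      fin_cases a <;> simp_all
  notMem := mixRho_notMem i

theorem finset_fin_four_cases (S : Finset (Fin 4)) : S = ∅ ∨ (∃ k, S = {k}) ∨ (∃ k, {k}ᶜ ⊆ S) ∨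
    S = {0, 1} ∨ S = {0, 2} ∨ S = {0, 3} ∨ S = {1, 2} ∨ S = {1, 3} ∨ S = {2, 3} := by
  revert S; decide

/-- The mix is a polytope as soon as the intersection of the groups of facet and vertex-figure is no
larger than it should be. -/
theorem isPolytope_iff (i : I) : IsPolytope (Mix I) Face.rank 4 ↔
    ∀ g ∈ reflGroup (mixRho I) {0}ᶜ, g ∈ reflGroup (mixRho I) {3}ᶜ →
      g ∈ reflGroup (mixRho I) {1, 2} := by
  rw [show IsPolytope (Mix I) Face.rank 4 ↔ _ from (isStringGroup i).isPolytope_iff (isThin i)]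
  constructor
  · refine fun h g h0 h3 => h _ g (reflGroup_mono (Set.subset_univ _) h0) fun k hk => ?_
    fin_cases k <;> simp_all
  · intro h J g hg hJ
    classical
    obtain ⟨S, rfl⟩ : ∃ S : Finset (Fin 4), J = S := ⟨J.toFinset, by simp⟩
    rcases finset_fin_four_cases S with rfl | ⟨k, rfl⟩ | ⟨k, hk⟩ | rfl | rfl | rfl | rfl | rfl | rfl
    · rw [eq_one_of_forall fun k => hJ k (by simp)]
      exact one_mem _
    · rw [Finset.coe_singleton] at hJ ⊢
      exact mem_reflGroup_singleton_of_apply hg (apply_mem_reflGroup_of_forall hJ)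
    · by_cases hkS : k ∈ S
      · refine reflGroup_mono (fun a _ => ?_) hg
        by_cases ha : a = k
        · exact ha ▸ hkS
        · exact hk (by simpa using ha)
      · refine reflGroup_mono (fun a ha => hk (by simpa using ha)) (hJ k hkS)
    · push_cast
      exact mem_reflGroup_of_mem_compl (c := 3) (by simp) i (compl_two_eq ▸ hJ 2 (by simp))
        (hJ 3 (by simp))
    · push_cast
      exact mem_reflGroup_zero_two (hJ 1 (by simp)) (hJ 3 (by simp))
    · push_cast
      exact mem_reflGroup_zero_three (hJ 1 (by simp)) (hJ 2 (by simp))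
    · push_cast
      exact h g (hJ 0 (by simp)) (hJ 3 (by simp))
    · push_cast
      exact mem_reflGroup_one_three (hJ 0 (by simp)) (hJ 2 (by simp))
    · push_cast
      exact mem_reflGroup_of_mem_compl (c := 0) (by simp) i (compl_one_eq ▸ hJ 1 (by simp))
        (hJ 0 (by simp))

end Intersection

/-! ### Polytopality -/

/-- The condition on `I` for the mix `P_I` to be a polytope. -/
def IsPolytopal (I : Finset Convex4) : Prop :=
  P₁ ∈ I ∨ (P₂ ∉ I ∧ P₃ ∉ I) ∨ (P₅ ∉ I ∧ P₆ ∉ I)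

instance (I : Finset Convex4) : Decidable (IsPolytopal I) :=
  inferInstanceAs (Decidable (P₁ ∈ I ∨ (P₂ ∉ I ∧ P₃ ∉ I) ∨ (P₅ ∉ I ∧ P₆ ∉ I)))

set_option maxRecDepth 100000 in
/-- Apart from `P₄`, some member of `I` shares its vertex-figure or its facet with each of the
others, if there are any. -/
theorem IsPolytopal.exists_center {I : Finset Convex4} (hI : IsPolytopal I) :
    I ⊆ {P₄} ∨ ∃ i ∈ I, i ≠ P₄ ∧ ∀ j ∈ I, j ≠ P₄ → ∃ v : Side, v.rep i = v.rep j := by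
  revert I; decide +kernel

theorem orderOf_rho_mul (i : Convex4) : orderOf (rho i 1 * rho i 2) = schlafli i 1 :=
  orderOf_rotation i 1

theorem schlafli_one (i : Convex4) (hi : i ≠ P₄) : schlafli i 1 = 3 := by
  revert i; decide

theorem mixRho_mul_zpow_apply {I : Finset Convex4} (n : ℤ) (j : I) :
    ((mixRho I 1 * mixRho I 2) ^ n) j = (rho j 1 * rho j 2) ^ n := rfl

theorem mem_reflGroup_omitted (v : Side) {I : Finset Convex4} {g : MixCoxGroup I}
    (h0 : g ∈ reflGroup (mixRho I) {0}ᶜ) (h3 : g ∈ reflGroup (mixRho I) {3}ᶜ) :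
    g ∈ reflGroup (mixRho I) {v.omitted}ᶜ := by
  cases v
  · exact h0
  · exact h3

/-- An element of both the facet group and the vertex-figure group has the same exponents in any two
polytopes with the same facets or the same vertex-figures, hence in all polytopes but `P₄`. -/
theorem IsPolytopal.mem_zpowers {I : Finset Convex4} (hI : IsPolytopal I) {g : MixCoxGroup I}
    (hg : ∀ v : Side, g ∈ evenGroup (mixRho I) {v.omitted}ᶜ)
    (hpow : ∀ i : I, ∃ e : ℤ, g i = (rho i 1 * rho i 2) ^ e) :
    g ∈ Subgroup.zpowers (mixRho I 1 * mixRho I 2) := by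
  choose e he using hpow
  obtain ⟨E, hE⟩ : ∃ E : ℤ, ∀ j : I, (j : Convex4) ≠ P₄ → g j = (rho j 1 * rho j 2) ^ E := by
    rcases hI.exists_center with h | ⟨i, hi, hi4, h⟩
    · exact ⟨0, fun j hj => absurd (Finset.mem_singleton.1 (h j.2)) hj⟩
    · refine ⟨e ⟨i, hi⟩, fun j hj => ?_⟩
      obtain ⟨v, hv⟩ := h j j.2 hj
      exact v.eq_pow_of_rep_eq I (hg v) (i := ⟨i, hi⟩) hv (he ⟨i, hi⟩)
  have hpow3 : ∀ (j : Convex4) (n : ℤ), j ≠ P₄ → (rho j 1 * rho j 2) ^ (3 * n) = 1 :=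
      fun j n hj => by
    rw [← orderOf_dvd_iff_zpow_eq_one, orderOf_rho_mul, schlafli_one j hj]
    exact dvd_mul_right _ _
  have hpow4 : ∀ n : ℤ, (rho P₄ 1 * rho P₄ 2) ^ (4 * n) = 1 := fun n => by
    rw [← orderOf_dvd_iff_zpow_eq_one, orderOf_rho_mul]
    exact dvd_mul_right _ _
  by_cases h4 : P₄ ∈ I
  · -- the rotation has order 4 in `P₄` and 3 elsewhere: the exponents are combined
    refine ⟨E + 3 * (E - e ⟨P₄, h4⟩), funext fun j => ?_⟩
    refine (mixRho_mul_zpow_apply _ j).trans ?_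
    by_cases hj : (j : Convex4) = P₄
    · obtain ⟨j, hjI⟩ := j
      obtain rfl : j = P₄ := hj
      rw [he, show E + 3 * (E - e ⟨P₄, h4⟩) = e ⟨P₄, h4⟩ + 4 * (E - e ⟨P₄, h4⟩) by ring, zpow_add,
        hpow4, mul_one]
    · rw [zpow_add, hpow3 _ _ hj, mul_one, hE j hj]
  · exact ⟨E, funext fun j => (hE j fun hj => h4 (hj ▸ j.2)).symm⟩

theorem IsPolytopal.mem_reflGroup_one_two {I : Finset Convex4} (hI : IsPolytopal I) (i : I)
    {g : MixCoxGroup I} (h0 : g ∈ reflGroup (mixRho I) {0}ᶜ)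
    (h3 : g ∈ reflGroup (mixRho I) {3}ᶜ) : g ∈ reflGroup (mixRho I) {1, 2} := by
  have heven : ∀ g : MixCoxGroup I, (∀ v : Side, g ∈ reflGroup (mixRho I) {v.omitted}ᶜ) →
      sign i (g i) = 1 → g ∈ reflGroup (mixRho I) {1, 2} := fun g hg hs => by
    refine evenGroup_le_reflGroup ?_
    rw [evenGroup_pair (mixRho_mul_self I)]
    refine hI.mem_zpowers (fun v => ?_) fun j => ?_
    · rw [mem_evenGroup_iff (mixRho_mul_self I) (isStringGroup i).sign]
      exact ⟨hg v, hs⟩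
    · have hj : g j ∈ evenGroup (rho j) {1, 2} := by
        rw [mem_evenGroup_iff (rho_mul_self j) (sign_rho j), ← hs]
        refine ⟨apply_mem_reflGroup_of_forall (fun k hk => ?_) j,
          sign_apply_eq (hg .facet) j i⟩
        fin_cases k
        · exact hg .vertexFigure
        · simp at hk
        · simp at hk
        · exact hg .facet
      rw [evenGroup_pair (rho_mul_self j)] at hj
      exact hj.imp fun _ => Eq.symm
  rcases Int.units_eq_one_or (sign i (g i)) with hs | hs
  · exact heven g (fun v => mem_reflGroup_omitted v h0 h3) hs
  · have h1 := heven (g * mixRho I 1) (fun v => mul_mem (mem_reflGroup_omitted v h0 h3)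
      (mem_reflGroup (by revert v; decide)))
      (by rw [Pi.mul_apply, map_mul, hs, mixRho, sign_rho]; decide)
    exact (Subgroup.mul_mem_cancel_right _ (mem_reflGroup (by simp))).1 h1

/-- Without `P₁`, the tuple that rotates in `P₅`, `P₆` and is trivial in the other polytopes belongs
to the group of the vertex-figure and to that of the facet, but is not a power of the rotation that
they share. -/
theorem isPolytopal_of_mem {I : Finset Convex4} (i : I)
    (h : ∀ g ∈ reflGroup (mixRho I) {0}ᶜ, g ∈ reflGroup (mixRho I) {3}ᶜ →
      g ∈ reflGroup (mixRho I) {1, 2}) : IsPolytopal I := by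
  by_contra hI
  obtain ⟨h1, h23, h56⟩ : P₁ ∉ I ∧ (P₂ ∈ I ∨ P₃ ∈ I) ∧ (P₅ ∈ I ∨ P₆ ∈ I) := by
    unfold IsPolytopal at hI
    tauto
  obtain ⟨a, ha, ha', ha4⟩ : ∃ a ∈ I, ¬ (a = P₅ ∨ a = P₆) ∧ a ≠ P₄ := by
    rcases h23 with h | h
    · exact ⟨_, h, by decide⟩
    · exact ⟨_, h, by decide⟩
  obtain ⟨b, hb, hb', hb4⟩ : ∃ b ∈ I, (b = P₅ ∨ b = P₆) ∧ b ≠ P₄ := by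
    rcases h56 with h | h
    · exact ⟨_, h, by decide⟩
    · exact ⟨_, h, by decide⟩
  set g : MixCoxGroup I := fun l => if (l : Convex4) = P₅ ∨ (l : Convex4) = P₆ then
    rho l 1 * rho l 2 else 1 with hg
  have hmem : ∀ v : Side, g ∈ evenGroup (mixRho I) {v.omitted}ᶜ := by
    have hvertex : ∀ l ≠ P₁, Side.vertexFigure.rep l = P₁ ↔ l = P₅ ∨ l = P₆ := by decide
    have hfacet : ∀ l, Side.facet.rep l = P₅ ∨ Side.facet.rep l = P₆ ↔ l = P₅ ∨ l = P₆ := by decide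
    rintro (_ | _)
    · have := Side.vertexFigure.ite_mem_evenGroup I (· = P₁)
      rwa [show (fun i : I => if Side.vertexFigure.rep i = P₁ then
        rho i 1 * rho i 2 else 1) = g from
        funext fun l => if_congr (hvertex l fun e => h1 (e ▸ l.2)) rfl rfl] at this
    · have := Side.facet.ite_mem_evenGroup I fun d => d = P₅ ∨ d = P₆
      rwa [show (fun i : I => if Side.facet.rep i = P₅ ∨ Side.facet.rep i = P₆ then
        rho i 1 * rho i 2 else 1) = g from
        funext fun l => if_congr (hfacet l) rfl rfl] at this
  have h12 := h g (evenGroup_le_reflGroup (hmem .vertexFigure))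
    (evenGroup_le_reflGroup (hmem .facet))
  have heven := (mem_evenGroup_iff (mixRho_mul_self I) (isStringGroup i).sign).2
    ⟨h12, sign_of_mem_evenGroup (isStringGroup i).sign (hmem .facet)⟩
  rw [evenGroup_pair (mixRho_mul_self I)] at heven
  obtain ⟨n, hn⟩ := heven
  have hna : (rho a 1 * rho a 2) ^ n = 1 :=
    (congrFun hn ⟨a, ha⟩).trans (if_neg ha')
  have hnb : (rho b 1 * rho b 2) ^ n = rho b 1 * rho b 2 :=
    (congrFun hn ⟨b, hb⟩).trans (if_pos hb')
  rw [← orderOf_dvd_iff_zpow_eq_one, orderOf_rho_mul, schlafli_one a ha4, ← schlafli_one b hb4,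
    ← orderOf_rho_mul, orderOf_dvd_iff_zpow_eq_one, hnb, ← orderOf_eq_one_iff, orderOf_rho_mul,
    schlafli_one b hb4] at hna
  omega

theorem isPolytope_mix_iff {I : Finset Convex4} (i : I) :
    IsPolytope (Mix I) Face.rank 4 ↔ IsPolytopal I := by
  rw [isPolytope_iff i]
  exact ⟨isPolytopal_of_mem i, fun hI g h0 h3 => hI.mem_reflGroup_one_two i h0 h3⟩

/-! ### Numbers of faces and flags -/

theorem numFlags_eq {I : Finset Convex4} (i : I) :
    numFlags I = 2 * ∏ j ∈ I, rotationOrder j := by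
  rw [numFlags, (isStringGroup i).card_flag (isThin i), card_mixRotationGroup]

theorem numFaces_mul {I : Finset Convex4} (i : I) (k : Fin 4) :
    numFaces I k * Nat.card (evenGroup (mixRho I) {k}ᶜ) = ∏ j ∈ I, rotationOrder j := by
  have h := card_face (mixRotationGen I) k.succ.castSucc
  rw [show ((k.succ.castSucc : Fin 6) : ℤ) - 1 = k by simp] at h
  have hs := isStringGroup i
  have hcard : Nat.card (evenGroup (mixRho I) {k}ᶜ) =
      Nat.card (faceGroup (mixRotationGen I) k.succ.castSucc) := by
    rw [← faceSet_succ_castSucc, ← map_partGroup hs.mul_self hs.map_gen]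
    exact (Nat.card_congr (Subgroup.equivMapOfInjective _ _ hs.injective).toEquiv).symm
  rw [numFaces, h, hcard, Subgroup.index_mul_card, card_mixRotationGroup]

theorem orderOf_mixRho_mul (I : Finset Convex4) (k : Fin 3) :
    orderOf (mixRho I k.castSucc * mixRho I k.succ) = I.lcm fun i => schlafli i k := by
  refine dvd_antisymm ?_ (Finset.lcm_dvd fun i hi => ?_)
  · rw [orderOf_dvd_iff_pow_eq_one]
    funext i
    change rotation i k ^ _ = 1
    rw [← orderOf_dvd_iff_pow_eq_one, orderOf_rotation]
    exact Finset.dvd_lcm i.2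
  · rw [← orderOf_rotation, orderOf_dvd_iff_pow_eq_one]
    exact congrFun (pow_orderOf_eq_one (mixRho I k.castSucc * mixRho I k.succ)) ⟨i, hi⟩

/-- A reflection `c` outside `K` that commutes with those in `K` doubles the order. -/
theorem card_evenGroup_union {I : Finset Convex4} (i : I) {K : Set (Fin 4)} {c : Fin 4}
    (hK : ∀ a ∈ K, (a : ℕ) + 2 ≤ c ∨ (c : ℕ) + 2 ≤ a) (hne : K.Nonempty) :
    Nat.card (evenGroup (mixRho I) ({c} ∪ K)) = 2 * Nat.card (evenGroup (mixRho I) K) := by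
  have hs := isStringGroup i
  have hcK : K ⊆ {c}ᶜ := fun a ha (e : a = c) => by rcases hK a ha with h | h <;> omega
  have hc : mixRho I c ∉ reflGroup (mixRho I) K := fun h =>
    mixRho_notMem i c (reflGroup_mono hcK h)
  have hle : reflGroup (mixRho I) K ≤ reflGroup (mixRho I) ({c} ∪ K) :=
    reflGroup_mono Set.subset_union_right
  have hindex : ((reflGroup (mixRho I) K).subgroupOf
      (reflGroup (mixRho I) ({c} ∪ K))).index = 2 := by
    rw [Subgroup.index_eq_two_iff]
    refine ⟨⟨mixRho I c, mem_reflGroup (by simp)⟩, ?_⟩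
    rintro ⟨g, hg⟩
    obtain ⟨u, hu, l, hl, rfl⟩ := exists_mul_of_mem_reflGroup_union (mixRho_mul_self I)
      (mixRho_comm_of_far hK) hg
    rw [Subgroup.mem_subgroupOf, Subgroup.mem_subgroupOf]
    change Xor (u * l * mixRho I c ∈ _) (u * l ∈ _)
    rcases mem_reflGroup_singleton (mixRho_mul_self I) hu with rfl | rfl
    · rw [one_mul]
      exact .inr ⟨hl, fun h' => hc ((Subgroup.mul_mem_cancel_left _ hl).1 h')⟩
    · refine .inl ⟨?_, fun h' => hc ((Subgroup.mul_mem_cancel_right _ hl).1 h')⟩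
      have hcomm : mixRho I c * l = l * mixRho I c := by
        refine (reflGroup_induction_right (p := fun l => mixRho I c * l = l * mixRho I c)
          (mixRho_mul_self I) (by simp) (fun g _ a ha h' => ?_) hl)
        rw [← mul_assoc, h', mul_assoc, mixRho_comm_of_far hK c rfl a ha, mul_assoc]
      rwa [hcomm, mul_assoc, mixRho_mul_self, mul_one]
  have hcard := ((reflGroup (mixRho I) K).subgroupOf
    (reflGroup (mixRho I) ({c} ∪ K))).index_mul_card
  rw [hindex, Nat.card_congr (Subgroup.subgroupOfEquivOfLe hle).toEquiv,
    card_reflGroup (mixRho_mul_self I) hs.sign hne,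
    card_reflGroup (mixRho_mul_self I) hs.sign (hne.inr)] at hcard
  omega

theorem card_evenGroup_compl_one {I : Finset Convex4} (i : I) :
    Nat.card (evenGroup (mixRho I) {1}ᶜ) = 2 * I.lcm fun j => schlafli j 2 := by
  rw [compl_one_eq, card_evenGroup_union i (by simp) (by simp),
    card_evenGroup_pair (mixRho_mul_self I)]
  exact congrArg _ (orderOf_mixRho_mul I 2)

theorem card_evenGroup_compl_two {I : Finset Convex4} (i : I) :
    Nat.card (evenGroup (mixRho I) {2}ᶜ) = 2 * I.lcm fun j => schlafli j 0 := by
  rw [compl_two_eq, card_evenGroup_union i (by simp) (by simp),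
    card_evenGroup_pair (mixRho_mul_self I)]
  exact congrArg _ (orderOf_mixRho_mul I 0)

/-! ### The table -/

/-- The entries of a row of the table have the values that follow from the orders of the rotation
group of the mix and of the stabilizers of its base faces, and from the criterion for polytopality.
-/
def Row.IsCorrect (row : Row) : Prop :=
  row.I.Nonempty ∧
  (row.f₀ * ∏ d ∈ Side.vertexFigure.types row.I, Side.rotOrder d = ∏ j ∈ row.I, rotationOrder j) ∧
  (row.f₁ * (2 * row.I.lcm fun j => schlafli j 2) = ∏ j ∈ row.I, rotationOrder j) ∧
  (row.f₂ * (2 * row.I.lcm fun j => schlafli j 0) = ∏ j ∈ row.I, rotationOrder j) ∧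
  (row.f₃ * ∏ d ∈ Side.facet.types row.I, Side.rotOrder d = ∏ j ∈ row.I, rotationOrder j) ∧
  row.g = 2 * ∏ j ∈ row.I, rotationOrder j ∧
  (IsPolytopal row.I ↔ row.polytopal = true)

instance (row : Row) : Decidable row.IsCorrect := by
  unfold Row.IsCorrect
  infer_instance

set_option maxRecDepth 100000 in
theorem isCorrect_of_mem_mixTable : ∀ row ∈ mixTable, row.IsCorrect := by decide +kernel

theorem eq_of_mul_card_eq {E : Type*} [Group E] {H : Subgroup E} {a b n : ℕ} (hn : 0 < n)
    (ha : a * Nat.card H = n) (hb : b * Nat.card H = n) : a = b :=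
  Nat.eq_of_mul_eq_mul_right (Nat.pos_of_ne_zero fun h => by rw [h, mul_zero] at ha; omega)
    (ha.trans hb.symm)

set_option maxRecDepth 100000 in
theorem exists_row_mem_mixTable :
    ∀ I : Finset Convex4, 2 ≤ I.card → ∃ row ∈ mixTable, row.I = I := by
  decide +kernel

set_option maxRecDepth 100000 in
theorem nodup_map_mixTable : (mixTable.map Row.I).Nodup := by decide +kernel

end PolytopeMix

open PolytopeMix
theorem mainTheorem4 :
    (∀ I : Finset Convex4, mixRotationGroup I = ⊤) ∧
    (∀ I : Finset Convex4, I.Nonempty →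
      IsPrePolytope (Mix I) Face.rank 4 ∧ FlagConnected (Mix I)) ∧
    (∀ I : Finset Convex4, 2 ≤ I.card → ∃! row, row ∈ mixTable ∧ row.I = I) ∧
    (∀ row ∈ mixTable,
      numFaces row.I 0 = row.f₀ ∧
      numFaces row.I 1 = row.f₁ ∧
      numFaces row.I 2 = row.f₂ ∧
      numFaces row.I 3 = row.f₃ ∧
      numFlags row.I = row.g ∧
      (IsPolytope (Mix row.I) Face.rank 4 ↔ row.polytopal = true)) := by
  refine ⟨mixRotationGroup_eq_top, fun I ⟨i, hi⟩ => ?_, fun I hI => ?_, fun row hrow => ?_⟩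
  · have hs := isStringGroup (I := I) ⟨i, hi⟩
    exact ⟨hs.isPrePolytope (isThin ⟨i, hi⟩), hs.flagConnected (isThin ⟨i, hi⟩)⟩
  · obtain ⟨row, hrow, rfl⟩ := exists_row_mem_mixTable I hI
    exact ⟨row, ⟨hrow, rfl⟩, fun row' h =>
      List.inj_on_of_nodup_map nodup_map_mixTable h.1 hrow h.2⟩
  · obtain ⟨⟨i, hi⟩, h0, h1, h2, h3, hg, hp⟩ := isCorrect_of_mem_mixTable row hrow
    have hpos : 0 < ∏ j ∈ row.I, rotationOrder j :=
      Finset.prod_pos fun j _ => by cases j <;> decide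
    have hcount := numFaces_mul (I := row.I) ⟨i, hi⟩
    refine ⟨?_, ?_, ?_, ?_, ?_, ?_⟩
    · rw [← Side.card_evenGroup_mixRho_compl] at h0
      exact eq_of_mul_card_eq hpos (hcount 0) h0
    · rw [← card_evenGroup_compl_one ⟨i, hi⟩] at h1
      exact eq_of_mul_card_eq hpos (hcount 1) h1
    · rw [← card_evenGroup_compl_two ⟨i, hi⟩] at h2
      exact eq_of_mul_card_eq hpos (hcount 2) h2
    · rw [← Side.card_evenGroup_mixRho_compl] at h3
      exact eq_of_mul_card_eq hpos (hcount 3) h3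
    · rw [numFlags_eq ⟨i, hi⟩, hg]
    · rw [isPolytope_mix_iff ⟨i, hi⟩, hp]
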